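/- **Setting (time correlated rewards).** Let $G=(I,T,E)$ be a finite bipartite graph with resources $I$ and arrivals $T=\{1,\dots,m\}$, which arrive in this order. Resource $i$ has a reward $r_i\ge 0$ and a probability $p_i\in[0,1]$, and $\mathcal S_T$ is an arbitrary probability distribution on $\{0,1\}^m$. Draw $(s_t)_{t\in T}\sim\mathcal S_T$ and, independently of it, independent Bernoulli variables $s_i^{(t)}$ ($(i,t)\in E$) with $\Pr[s_i^{(t)}=1]=p_i$, so that $s_i^{(t)}$ is a fresh copy of a Bernoulli($p_i$) variable $s_i$ for each attempt to match $i$. The edge $(i,t)$ succeeds if and only if $s_i^{(t)}s_t=1$. Its marginal success probability is therefore $p_{it}=p_i\Pr[s_t=1]$. Each arrival is matched at most once. If $(i,t)\in E$ is included in the matching and succeeds, the reward $r_i$ is obtained and $i$ becomes unavailable; if it fails, there is no reward, $t$ is lost, and $i$ stays available. *Perturbed Greedy* draws independent $y_i\sim U[0,1]$ ($i\in I$), independent of the rewards, and processes the arrivals in order. It matches each arrival $t$ to an available neighbor $i$ that maximizes $p_{it}\,r_i\,(1-e^{y_i-1})$ (ties are broken by an arbitrary rule that may depend on $t$ and on the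 history), and leaves $t$ unmatched if no neighbor is available. It uses only the marginal probabilities $p_{it}$, not the joint distribution. Let $\mathrm{ALG}$ be its expected total reward. A *non-anticipative offline algorithm* knows the whole instance, including $G$, the $r_i$, the $p_i$ and the joint distribution $\mathcal S_T$. It may be randomized, with a random seed independent of the rewards. It adaptively includes edges $(i,t)\in E$ with $i$ available and $t$ not yet matched, in any order of the arrivals, and may stop at any time. The outcome of an edge is revealed to it immediately after the edge is included in the matching, and not before. Let $\mathrm{OPT}$ be the supremum of the expected total reward over all such algorithms. **Theorem.** For every instance of the time correlated rewards setting and every tie-breaking rule, $\mathrm{OPT}$ is finite and $$\mathrm{ALG}\ \ge\ \Big(1-\frac1e\Big)\,\mathrm{OPT},$$ that is, Perturbed Greedy is $(1-1/e)$-competitive against the non-anticipative offline benchmark that knows the joint distribution. -/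

import Mathlib

open MeasureTheory

noncomputable section

namespace TimeCorrelated

/-- An instance of vertex-weighted online bipartite matching with time correlated rewards, with
resources `I` and arrivals `0, …, m - 1` in this order. -/
structure Instance (I : Type*) (m : ℕ) where
  /-- `nbr t` is the set of resources that share an edge with the arrival `t`. -/
  nbr : Fin m → Finset I
  /-- The reward (vertex weight) of each resource. -/
  r : I → ℝ
  r_nonneg : ∀ i, 0 ≤ r i
  /-- The success probability of the Bernoulli variable `s_i`. -/
  p : I → ℝ
  p_nonneg : ∀ i, 0 ≤ p i
  p_le_one : ∀ i, p i ≤ 1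
  /-- The joint probability mass function of `(s_t)`, an arbitrary one on `{0,1}^m`. -/
  joint : (Fin m → Bool) → ℝ
  joint_nonneg : ∀ s, 0 ≤ joint s
  joint_sum : ∑ s, joint s = 1

/-- What has been observed so far: the edges included in the matching, the most recent one first,
each with its outcome (`true` for success). -/
abbrev History (I : Type*) (m : ℕ) := List ((I × Fin m) × Bool)

/-- Resource `i` has not been matched successfully yet. -/
def Available {I : Type*} {m : ℕ} (h : History I m) (i : I) : Prop :=
  ∀ t, ((i, t), true) ∉ h

/-- Arrival `t` has not been matched yet, neither successfully nor unsuccessfully. -/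
def Unmatched {I : Type*} {m : ℕ} (h : History I m) (t : Fin m) : Prop :=
  ∀ i b, ((i, t), b) ∉ h

/-- A tie-breaking rule: it picks an element of a nonempty set of resources, possibly depending on
the history and on the current arrival. -/
abbrev TieBreak (I : Type*) (m : ℕ) :=
  History I m → Fin m → ∀ A : Finset I, A.Nonempty → {i : I // i ∈ A}

/-- The elements of `A` at which `f` attains its maximum over `A`. -/
def maximizers {I : Type*} (f : I → ℝ) (A : Finset I) : Finset I :=
  A.filter fun i => ∀ j ∈ A, f j ≤ f i

theorem maximizers_nonempty {I : Type*} (f : I → ℝ) {A : Finset I} (hA : A.Nonempty) :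
    (maximizers f A).Nonempty := by
  obtain ⟨i, hi, hmax⟩ := A.exists_max_image f hA
  exact ⟨i, Finset.mem_filter.mpr ⟨hi, hmax⟩⟩

open Classical in
/-- The offer of Perturbed Greedy to the arrival `t`: an available neighbour of `t` that maximizes
`p_{it} r_i (1 - e^{y_i - 1})`, if there is an available neighbour. All that it looks at is
the rewards `r`, the neighbours `nbr_t` and the (marginal) success probabilities `prob_t` of the
edges at `t`, the seeds `y` and the history. -/
def greedyOffer {I : Type*} {m : ℕ} (tie : TieBreak I m) (r : I → ℝ) (y : I → ℝ)
    (h : History I m) (t : Fin m) (nbr_t : Finset I) (prob_t : I → ℝ) : Option I :=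
  if hA : (nbr_t.filter fun i => Available h i).Nonempty then
    some (tie h t
      (maximizers (fun i => prob_t i * r i * (1 - Real.exp (y i - 1)))
        (nbr_t.filter fun i => Available h i))
      (maximizers_nonempty _ hA)).1
  else none

namespace Instance

variable {I : Type*} {m : ℕ}

/-- The marginal probability that `s_t = 1`. -/
def arrivalProb (ν : Instance I m) (t : Fin m) : ℝ :=
  ∑ s : Fin m → Bool, if s t = true then ν.joint s else 0

/-- The marginal success probability `p_{it}` of the edge `(i, t)`. -/
def edgeProb (ν : Instance I m) (i : I) (t : Fin m) : ℝ :=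
  ν.p i * ν.arrivalProb t

/-- The total reward of a completed execution: `r_i` for every successful match of `i`. -/
def reward (ν : Instance I m) (h : History I m) : ℝ :=
  (h.map fun e => if e.2 = true then ν.r e.1.1 else 0).sum

/-- The expectation of `F` applied to the table of edge outcomes. The edge `(i, t)` succeeds iff
`x i t = true` and `s t = true`, where `s` has the given joint distribution and, independently of
`s`, the `x i t` are independent; `x i t` is the copy of the Bernoulli(`p i`) variable `s_i` that is
drawn for the edge `(i, t)`. -/
def expectation [Fintype I] [DecidableEq I] (ν : Instance I m)
    (F : (I → Fin m → Bool) → ℝ) : ℝ :=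
  ∑ s : Fin m → Bool, ∑ x : I → Fin m → Bool,
    ν.joint s * (∏ i, ∏ t, if x i t = true then ν.p i else 1 - ν.p i) *
      F (fun i t => x i t && s t)

/-- The execution of Perturbed Greedy with seeds `y` when the edge outcomes are given by `w`: the
arrivals are processed in order, and each is matched to the resource that it is offered. -/
def greedyRun (ν : Instance I m) (tie : TieBreak I m) (y : I → ℝ) (w : I → Fin m → Bool) :
    History I m :=
  (List.finRange m).foldl
    (fun h t =>
      match greedyOffer tie ν.r y h t (ν.nbr t) (fun i => ν.edgeProb i t) with
      | none => h
      | some i => ((i, t), w i t) :: h)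
    []

/-- The expected total reward of Perturbed Greedy, whose seeds `y i` are independent and uniform
on `[0,1]`, and independent of the outcomes. -/
def perturbedGreedy [Fintype I] [DecidableEq I] (ν : Instance I m) (tie : TieBreak I m) : ℝ :=
  ∫ y : I → ℝ, ν.expectation (fun w => ν.reward (ν.greedyRun tie y w))
    ∂(Measure.pi fun _ : I => (volume : Measure ℝ).restrict (Set.Icc 0 1))

end Instance

/-- A (possibly randomized) non-anticipative offline algorithm for the instance `ν`. Given its
random seed and what it has observed so far, it includes a further edge in the matching, in any
order of the arrivals, or stops. It may depend on all of `ν`, in particular on the joint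
distribution; it sees the outcome of an edge only once the edge is in the matching. -/
structure OfflineAlgorithm {I : Type*} {m : ℕ} (ν : Instance I m) where
  Seed : Type
  measurableSeed : MeasurableSpace Seed
  law : Measure Seed
  isProbability : IsProbabilityMeasure law
  act : Seed → History I m → Option (I × Fin m)
  measurable_act : ∀ (h : History I m) (a : Option (I × Fin m)), MeasurableSet {z | act z h = a}
  edge : ∀ z h i t, act z h = some (i, t) → i ∈ ν.nbr t
  available : ∀ z h i t, act z h = some (i, t) → Available h i
  unmatched : ∀ z h i t, act z h = some (i, t) → Unmatched h t

namespace OfflineAlgorithm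

variable {I : Type*} {m : ℕ} {ν : Instance I m}

/-- The history after (at most) `k` matches when the seed is `z` and the outcomes are given
by `w`. -/
def run (A : OfflineAlgorithm ν) (z : A.Seed) (w : I → Fin m → Bool) : ℕ → History I m
  | 0 => []
  | k + 1 =>
    match A.act z (run A z w k) with
    | none => run A z w k
    | some (i, t) => ((i, t), w i t) :: run A z w k

/-- The expected total reward. Every match uses up an arrival, so that the execution is over after
`m` rounds. -/
def value [Fintype I] [DecidableEq I] (A : OfflineAlgorithm ν) : ℝ :=
  letI := A.measurableSeed
  ∫ z, ν.expectation (fun w => ν.reward (A.run z w m)) ∂A.law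

end OfflineAlgorithm

/-- The non-anticipative offline benchmark. -/
def Instance.opt {I : Type*} {m : ℕ} [Fintype I] [DecidableEq I] (ν : Instance I m) : ℝ :=
  ⨆ A : OfflineAlgorithm ν, A.value

end TimeCorrelated

end

/-!
Perturbed Greedy ranks the neighbours of an arrival `t` by `p_i Pr[s_t = 1] r_i (1 - e^{y_i - 1})`,
and the factor `Pr[s_t = 1]` is common to all of them. Hence the arrival variables can be fixed:
arrivals with `s_t = 0` change neither the available resources nor the reward, and on the others
the algorithm is a Markov chain on sets of available resources that tries the best available
neighbour, with one order of the resources for all arrivals (`mean_reward_greedyRun`). The offline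
algorithm is only helped by knowing `s`, and it enters the analysis through the probabilities
`x i t` of trying the edge `(i, t)` (`tryProb`). Its expected reward is `∑ p_i r_i x i t`
(`mean_reward_run`), every arrival has total weight at most one (`sum_tryProb_le_one`), and
`p_i ∑_{t ∈ S} x i t ≤ 1 - (1 - p_i)^|S|` for every set `S` of arrivals (`sum_tryProb_le_pow`),
because a success of `i` within `S` requires one of `|S|` independent Bernoulli variables to be one.

It remains to compare the chain with such weights `x`. The value `R_i = p_i r_i` of trying `i` is
split into `R_i (1 - e^{y_i - 1})` for the arrival and `R_i e^{y_i - 1}` for the resource, and the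
share of each arrival is distributed over its edges with the weights `x`. For a resource `i`, the
chain is compared with the chain without `i`, in which the arrival `t` receives a share `v_t`.
With `i` present, arrivals receive at least as much in expectation (`chainValue_mono_state`).
Moreover, the resources ranked above `i` evolve in the same way in both chains. So `i`, as long as
it is available, is tried at all its neighbours `t` with `v_t < R_i (1 - e^{y_i - 1})`, and the
inequality for `x` with the set `S` of these arrivals bounds from below the probability that `i` is
used up (`chainValue_count_bound`). An edge `(i, t)` thus yields at least
`v_t + R_i e^{y_i - 1} 1[v_t < R_i (1 - e^{y_i - 1})]` per unit of weight, where `v_t` does not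
depend on `y_i`, and the integral of this over `y_i ∈ [0,1]` is at least `R_i (1 - 1/e)`
(`le_integral_payoff`).
-/

open MeasureTheory

noncomputable section

namespace TimeCorrelated

/-! ### The Markov chain of available resources -/

section Chain

variable {I T : Type*}

/-- `σ` selects from every nonempty set a resource of maximal value, and nothing from `∅`. -/
def Selects (V : I → ℝ) (σ : Finset I → Option I) : Prop :=
  ∀ B : Finset I, (σ B = none ∧ B = ∅) ∨ ∃ a ∈ B, σ B = some a ∧ ∀ k ∈ B, V k ≤ V a

open Classical in
/-- The selection of a greatest element for the relation `ρ`. Going through the relation, of which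
there are finitely many, makes measurability in the seeds automatic. -/
def best (ρ : I → I → Prop) (B : Finset I) : Option I :=
  if h : ∃ j ∈ B, ∀ k ∈ B, ρ k j then some h.choose else none

theorem selects_best (V : I → ℝ) : Selects V (best fun k j => V k ≤ V j) := by
  intro B
  unfold best
  split_ifs with h
  · exact Or.inr ⟨h.choose, h.choose_spec.1, rfl, h.choose_spec.2⟩
  · refine Or.inl ⟨rfl, ?_⟩
    by_contra hB
    exact h (B.exists_max_image V (Finset.nonempty_iff_ne_empty.mpr hB))

open Classical in
theorem best_congr {ρ ρ' : I → I → Prop} {B : Finset I}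
    (h : ∀ j ∈ B, ∀ k ∈ B, (ρ k j ↔ ρ' k j)) : best ρ B = best ρ' B := by
  have : (fun j => j ∈ B ∧ ∀ k ∈ B, ρ k j) = fun j => j ∈ B ∧ ∀ k ∈ B, ρ' k j := by
    funext j
    refine propext (and_congr_right fun hj => forall₂_congr fun k hk => h j hj k hk)
  have key : ∀ Q Q' : I → Prop, Q = Q' → (if h : ∃ j, Q j then some h.choose else none)
      = if h : ∃ j, Q' j then some h.choose else none := by
    rintro Q _ rfl
    rfl
  unfold best
  convert key _ _ this

variable [DecidableEq I]

/-- The expectation of `f` at the next set of available resources, when `A` is the current one and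
the given resource, if any, is tried: a tried resource `a` is used up with probability `p a`. -/
def next (p : I → ℝ) (f : Finset I → ℝ) (A : Finset I) : Option I → ℝ
  | none => f A
  | some a => p a * f (A.erase a) + (1 - p a) * f A

/-- The expected total cost of the Markov chain whose state is the set `A` of available resources.
At each arrival `t` of the list the resource `σ (A ∩ N t)` is tried, which costs
`c t (σ (A ∩ N t))` and removes the resource from the state with its success probability. -/
def chainValue (p : I → ℝ) (N : T → Finset I) (σ : Finset I → Option I) (c : T → Option I → ℝ) :
    List T → Finset I → ℝ
  | [], _ => 0
  | t :: L, A => c t (σ (A ∩ N t)) + next p (chainValue p N σ c L) A (σ (A ∩ N t))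

theorem next_le {p : I → ℝ} (hp : ∀ i, 0 ≤ p i) (hp' : ∀ i, p i ≤ 1) {f : Finset I → ℝ}
    {A : Finset I} {o : Option I} {C : ℝ} (h : f A ≤ C) (h' : ∀ a ∈ o, f (A.erase a) ≤ C) :
    next p f A o ≤ C := by
  cases o with
  | none => exact h
  | some a =>
    have h1 := mul_le_mul_of_nonneg_left (h' a rfl) (hp a)
    have h2 := mul_le_mul_of_nonneg_left h (sub_nonneg.mpr (hp' a))
    simp only [next]
    linarith

theorem le_next {p : I → ℝ} (hp : ∀ i, 0 ≤ p i) (hp' : ∀ i, p i ≤ 1) {f : Finset I → ℝ}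
    {A : Finset I} {o : Option I} {C : ℝ} (h : C ≤ f A) (h' : ∀ a ∈ o, C ≤ f (A.erase a)) :
    C ≤ next p f A o := by
  cases o with
  | none => exact h
  | some a =>
    have h1 := mul_le_mul_of_nonneg_left (h' a rfl) (hp a)
    have h2 := mul_le_mul_of_nonneg_left h (sub_nonneg.mpr (hp' a))
    simp only [next]
    linarith

theorem next_mono {p : I → ℝ} (hp : ∀ i, 0 ≤ p i) (hp' : ∀ i, p i ≤ 1) {f g : Finset I → ℝ}
    {A B : Finset I} {o : Option I} (h : f A ≤ g B) (h' : ∀ a ∈ o, f (A.erase a) ≤ g (B.erase a)) :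
    next p f A o ≤ next p g B o := by
  cases o with
  | none => exact h
  | some a =>
    have h1 := mul_le_mul_of_nonneg_left (h' a rfl) (hp a)
    have h2 := mul_le_mul_of_nonneg_left h (sub_nonneg.mpr (hp' a))
    simp only [next]
    linarith

theorem next_const (p : I → ℝ) (C : ℝ) (A : Finset I) (o : Option I) :
    next p (fun _ => C) A o = C := by
  cases o with
  | none => rfl
  | some a => simp only [next]; ring

theorem next_affine (p : I → ℝ) (f : Finset I → ℝ) (C D : ℝ) (A : Finset I) (o : Option I) :
    next p (fun A => C + D * f A) A o = C + D * next p f A o := by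
  cases o with
  | none => rfl
  | some a => simp only [next]; ring

theorem next_sum {κ : Type*} (K : Finset κ) (p : I → ℝ) (f : κ → Finset I → ℝ) (A : Finset I)
    (o : Option I) :
    next p (fun A => ∑ k ∈ K, f k A) A o = ∑ k ∈ K, next p (f k) A o := by
  cases o with
  | none => rfl
  | some a => simp only [next, Finset.mul_sum, Finset.sum_add_distrib]

variable {p : I → ℝ} {N : T → Finset I} {σ : Finset I → Option I}

theorem chainValue_sum {κ : Type*} (K : Finset κ) (c : κ → T → Option I → ℝ) (L : List T)
    (A : Finset I) :
    chainValue p N σ (fun t o => ∑ k ∈ K, c k t o) L A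
      = ∑ k ∈ K, chainValue p N σ (c k) L A := by
  induction L generalizing A with
  | nil => simp [chainValue]
  | cons t L ih =>
    simp only [chainValue, Finset.sum_add_distrib]
    rw [← next_sum, show chainValue p N σ (fun t o => ∑ k ∈ K, c k t o) L
      = fun A => ∑ k ∈ K, chainValue p N σ (c k) L A from funext ih]

theorem chainValue_const_mul (D : ℝ) (c : T → Option I → ℝ) (L : List T) (A : Finset I) :
    chainValue p N σ (fun t o => D * c t o) L A = D * chainValue p N σ c L A := by
  induction L generalizing A with
  | nil => simp [chainValue]
  | cons t L ih =>
    simp only [chainValue]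
    rw [show chainValue p N σ (fun t o => D * c t o) L
      = fun A => 0 + D * chainValue p N σ c L A from funext fun A => by rw [ih, zero_add],
      next_affine]
    ring

theorem chainValue_add (c c' : T → Option I → ℝ) (L : List T) (A : Finset I) :
    chainValue p N σ (fun t o => c t o + c' t o) L A
      = chainValue p N σ c L A + chainValue p N σ c' L A := by
  simpa using chainValue_sum (p := p) (N := N) (σ := σ) Finset.univ
    (fun b : Bool => if b then c else c') L A

/-- Costs that do not depend on the resource that is tried are simply added up. -/
theorem chainValue_time (d : T → ℝ) (L : List T) (A : Finset I) :
    chainValue p N σ (fun t _ => d t) L A = (L.map d).sum := by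
  induction L generalizing A with
  | nil => simp [chainValue]
  | cons t L ih =>
    simp only [chainValue, List.map_cons, List.sum_cons]
    rw [show chainValue p N σ (fun t _ => d t) L = fun _ => (L.map d).sum from funext ih,
      next_const]

theorem chainValue_mono_cost (hp : ∀ i, 0 ≤ p i) (hp' : ∀ i, p i ≤ 1)
    {V : I → ℝ} (hσ : Selects V σ) {c c' : T → Option I → ℝ} {L : List T} {A : Finset I}
    (h : ∀ t ∈ L, ∀ o : Option I, (∀ a ∈ o, a ∈ A) → c t o ≤ c' t o) :
    chainValue p N σ c L A ≤ chainValue p N σ c' L A := by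
  induction L generalizing A with
  | nil => simp [chainValue]
  | cons t L ih =>
    simp only [chainValue]
    refine add_le_add (h t (by simp) _ ?_) (next_mono hp hp' ?_ ?_)
    · intro a ha
      rcases hσ (A ∩ N t) with ⟨h0, -⟩ | ⟨b, hb, hb', -⟩
      · simp [h0] at ha
      · rw [hb'] at ha
        cases ha
        exact (Finset.mem_inter.mp hb).1
    · exact ih fun t ht => h t (by simp [ht])
    · exact fun a _ => ih fun t ht o ho =>
        h t (by simp [ht]) o fun b hb => Finset.mem_of_mem_erase (ho b hb)

theorem chainValue_congr_cost (hp : ∀ i, 0 ≤ p i) (hp' : ∀ i, p i ≤ 1)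
    {V : I → ℝ} (hσ : Selects V σ) {c c' : T → Option I → ℝ} {L : List T} {A : Finset I}
    (h : ∀ t ∈ L, ∀ o : Option I, (∀ a ∈ o, a ∈ A) → c t o = c' t o) :
    chainValue p N σ c L A = chainValue p N σ c' L A :=
  le_antisymm (chainValue_mono_cost hp hp' hσ fun t ht o ho => (h t ht o ho).le)
    (chainValue_mono_cost hp hp' hσ fun t ht o ho => (h t ht o ho).ge)

theorem chainValue_congr {σ' : Finset I → Option I} {c : T → Option I → ℝ}
    {L : List T} {A : Finset I} (h : ∀ B ⊆ A, σ B = σ' B) :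
    chainValue p N σ c L A = chainValue p N σ' c L A := by
  induction L generalizing A with
  | nil => simp [chainValue]
  | cons t L ih =>
    simp only [chainValue]
    rw [h _ Finset.inter_subset_left]
    congr 1
    cases σ' (A ∩ N t) with
    | none => exact ih h
    | some a =>
      simp only [next]
      rw [ih h, ih fun B hB => h B (hB.trans (Finset.erase_subset _ _))]

/-- The expected cost is linear in the cost function, with the expected numbers of visits as
coefficients. -/
theorem chainValue_eq_sum [Fintype I] [Fintype T] [DecidableEq T] (c : T → Option I → ℝ)
    (L : List T) (A : Finset I) :
    chainValue p N σ c L A = ∑ t, ∑ o, c t o *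
      chainValue p N σ (fun t' o' => if t' = t ∧ o' = o then 1 else 0) L A := by
  simp_rw [← chainValue_const_mul, ← chainValue_sum]
  congr 1
  funext t o
  rw [Finset.sum_eq_single t, Finset.sum_eq_single o]
  · simp
  · intro o' _ ho'
    simp [ho'.symm]
  · simp
  · intro t' _ ht'
    exact Finset.sum_eq_zero fun o' _ => by simp [ht'.symm]
  · simp

theorem chainValue_count_eq_zero {V : I → ℝ} (hσ : Selects V σ) {i : I} {d : T → ℝ} (L : List T)
    {A : Finset I} (hi : i ∉ A) :
    chainValue p N σ (fun t o => if o = some i then d t else 0) L A = 0 := by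
  induction L generalizing A with
  | nil => rfl
  | cons t L ih =>
    have hne : σ (A ∩ N t) ≠ some i := by
      rcases hσ (A ∩ N t) with ⟨h0, -⟩ | ⟨b, hb, hb', -⟩
      · simp [h0]
      · rw [hb']
        rintro ⟨⟩
        exact hi (Finset.mem_inter.mp hb).1
    simp only [chainValue, if_neg hne, zero_add]
    cases σ (A ∩ N t) with
    | none => exact ih hi
    | some a =>
      simp [next, ih hi, ih (fun h => hi (Finset.mem_of_mem_erase h))]

/-- With more available resources, every arrival is matched at least as well in expectation. If
the tried resources differ, then the one of the larger state `B` does not belong to the smaller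
state `A`, so that the inclusion of the states survives either outcome. -/
theorem chainValue_mono_state (hp : ∀ i, 0 ≤ p i) (hp' : ∀ i, p i ≤ 1) {V : I → ℝ}
    (hσ : Selects V σ) {P : Finset I} (hV : ∀ i ∈ P, 0 ≤ V i)
    (hinj : ∀ i ∈ P, ∀ j ∈ P, V i = V j → i = j) {x : T → ℝ} (hx : ∀ t, 0 ≤ x t) (L : List T)
    {A B : Finset I} (hAB : A ⊆ B) (hB : B ⊆ P) :
    chainValue p N σ (fun t o => x t * o.elim 0 V) L A
      ≤ chainValue p N σ (fun t o => x t * o.elim 0 V) L B := by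
  induction L generalizing A B with
  | nil => simp [chainValue]
  | cons t L ih =>
    simp only [chainValue]
    rcases hσ (A ∩ N t) with ⟨hA0, hA1⟩ | ⟨a, ha, ha', ham⟩ <;>
      rcases hσ (B ∩ N t) with ⟨hB0, hB1⟩ | ⟨b, hb, hb', hbm⟩
    · rw [hA0, hB0]
      simpa [next] using ih hAB hB
    · rw [hA0, hb']
      have hbA : b ∉ A := fun h => by
        have : b ∈ A ∩ N t := Finset.mem_inter.mpr ⟨h, (Finset.mem_inter.mp hb).2⟩
        simp [hA1] at this
      refine add_le_add ?_ ?_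
      · simpa using mul_nonneg (hx t) (hV b (hB (Finset.mem_inter.mp hb).1))
      · refine le_next hp hp' (ih hAB hB) ?_
        rintro _ ⟨⟩
        exact ih (Finset.subset_erase.mpr ⟨hAB, hbA⟩) ((Finset.erase_subset _ _).trans hB)
    · have : a ∈ B ∩ N t := Finset.inter_subset_inter_right hAB ha
      simp [hB1] at this
    · rw [ha', hb']
      have hab : V a ≤ V b := hbm a (Finset.inter_subset_inter_right hAB ha)
      refine add_le_add (by simpa using mul_le_mul_of_nonneg_left hab (hx t)) ?_
      by_cases h : a = b
      · subst h
        exact next_mono hp hp' (ih hAB hB) fun c _ =>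
          ih (Finset.erase_subset_erase _ hAB) ((Finset.erase_subset _ _).trans hB)
      · have hbA : b ∉ A := fun hbA => h <| by
          have h1 := ham b (Finset.mem_inter.mpr ⟨hbA, (Finset.mem_inter.mp hb).2⟩)
          exact hinj a (hB (hAB (Finset.mem_inter.mp ha).1)) b (hB (Finset.mem_inter.mp hb).1)
            (le_antisymm hab h1)
        have key : next p (chainValue p N σ (fun t o => x t * o.elim 0 V) L) A (some a)
            ≤ chainValue p N σ (fun t o => x t * o.elim 0 V) L A :=
          next_le hp hp' le_rfl fun c _ => ih (Finset.erase_subset _ _) (hAB.trans hB)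
        refine key.trans (le_next hp hp' (ih hAB hB) ?_)
        rintro _ ⟨⟩
        exact ih (Finset.subset_erase.mpr ⟨hAB, hbA⟩) ((Finset.erase_subset _ _).trans hB)

/-- The probability that `i` is used up by the chain started from `B`, compared with the chain
started from a state `A` without `i`. Resources that are worth more than `i` evolve in the same way
in both chains, so that an arrival `t` adjacent to `i` tries `i`, if available, exactly when it
receives less than `V i` in the chain without `i`. With `S` the set of such arrivals, `i` survives
with probability `(1 - p i) ^ |S|`, which is at most `1 - p i * ∑ t ∈ S, x t` by hypothesis. In
the induction `S` holds the arrivals of this kind seen so far. -/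
theorem chainValue_count_bound [DecidableEq T] (hp : ∀ i, 0 ≤ p i) (hp' : ∀ i, p i ≤ 1) {V : I → ℝ}
    (hσ : Selects V σ) {P : Finset I} (hV : ∀ i ∈ P, 0 < V i)
    (hinj : ∀ i ∈ P, ∀ j ∈ P, V i = V j → i = j) {x : T → ℝ} {i : I} {L : List T} (hL : L.Nodup)
    {S : Finset T} (hSL : ∀ t ∈ L, t ∉ S)
    (hS : ∀ S' : Finset T, (∀ t ∈ S', t ∈ S ∨ t ∈ L) →
      p i * ∑ t ∈ S', x t ≤ 1 - (1 - p i) ^ S'.card)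
    {A B : Finset I} (hiB : i ∈ B) (hiA : i ∉ A) (hA : A ⊆ P) (hB : B ⊆ P)
    (hAB : ∀ j, V i < V j → (j ∈ A ↔ j ∈ B)) :
    (1 - p i) ^ S.card * (1 - p i *
        chainValue p N σ (fun _ o => if o = some i then 1 else 0) L B)
      ≤ 1 - p i * ∑ t ∈ S, x t - p i *
        chainValue p N σ (fun t o => if i ∈ N t ∧ o.elim 0 V < V i then x t else 0) L A := by
  induction L generalizing S A B with
  | nil =>
    have := hS S (by simp)
    simp only [chainValue]
    linarith
  | cons t L ih =>
    obtain ⟨htL, hL'⟩ := List.nodup_cons.mp hL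
    set f := chainValue p N σ (fun _ o => if o = some i then 1 else 0) L with hf
    set g := chainValue p N σ
      (fun t o => if i ∈ N t ∧ o.elim 0 V < V i then x t else 0) L with hg
    -- the induction hypothesis for the arrivals after `t`, when `t` is not of the kind collected
    have ih0 : ∀ A B : Finset I, i ∈ B → i ∉ A → A ⊆ P → B ⊆ P →
        (∀ j, V i < V j → (j ∈ A ↔ j ∈ B)) →
        (1 - p i) ^ S.card * (1 - p i * f B) ≤ 1 - p i * ∑ t ∈ S, x t - p i * g A :=
      fun A B h1 h2 h3 h4 h5 => ih hL' (fun u hu => hSL u (by simp [hu]))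
        (fun S' h => hS S' fun u hu => (h u hu).imp_right (by simp +contextual)) h1 h2 h3 h4 h5
    simp only [chainValue, ← hf, ← hg]
    have hAP : ∀ a, A.erase a ⊆ P := fun a => (Finset.erase_subset _ _).trans hA
    have hBP : ∀ a, B.erase a ⊆ P := fun a => (Finset.erase_subset _ _).trans hB
    by_cases hH : ∃ j ∈ B ∩ N t, V i < V j
    · obtain ⟨j, hj, hij⟩ := hH
      have hjA : j ∈ A ∩ N t := Finset.mem_inter.mpr
        ⟨(hAB j hij).mpr (Finset.mem_inter.mp hj).1, (Finset.mem_inter.mp hj).2⟩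
      rcases hσ (B ∩ N t) with ⟨-, h0⟩ | ⟨b, hb, hb', hbm⟩
      · simp [h0] at hj
      rcases hσ (A ∩ N t) with ⟨-, h0⟩ | ⟨a, ha, ha', ham⟩
      · simp [h0] at hjA
      have hib : V i < V b := hij.trans_le (hbm j hj)
      have hia : V i < V a := hij.trans_le (ham j hjA)
      have hab : a = b := by
        have h1 := hbm a (Finset.mem_inter.mpr
          ⟨(hAB a hia).mp (Finset.mem_inter.mp ha).1, (Finset.mem_inter.mp ha).2⟩)
        have h2 := ham b (Finset.mem_inter.mpr
          ⟨(hAB b hib).mpr (Finset.mem_inter.mp hb).1, (Finset.mem_inter.mp hb).2⟩)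
        exact hinj a (hA (Finset.mem_inter.mp ha).1) b (hB (Finset.mem_inter.mp hb).1)
          (le_antisymm h1 h2)
      subst hab
      have hai : a ≠ i := by rintro rfl; exact lt_irrefl _ hia
      rw [ha', hb']
      have h1 := ih0 A B hiB hiA hA hB hAB
      have h2 := ih0 (A.erase a) (B.erase a) (Finset.mem_erase.mpr ⟨hai.symm, hiB⟩)
        (fun h => hiA (Finset.mem_of_mem_erase h)) (hAP a) (hBP a)
        (fun j hj => by simp [hAB j hj])
      have h3 := mul_le_mul_of_nonneg_left h2 (hp a)
      have h4 := mul_le_mul_of_nonneg_left h1 (sub_nonneg.mpr (hp' a))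
      have h5 : ¬ (i ∈ N t ∧ (some a).elim 0 V < V i) := fun h => absurd h.2 (not_lt.mpr hia.le)
      have h6 : some a ≠ some i := fun h => hai (Option.some.inj h)
      simp only [next, if_neg h5, if_neg h6]
      linarith
    · push Not at hH
      have hHA : ∀ j ∈ A ∩ N t, V j < V i := by
        intro j hj
        by_contra! h
        rcases h.lt_or_eq with h | h
        · exact absurd (hH j (Finset.mem_inter.mpr
            ⟨(hAB j h).mp (Finset.mem_inter.mp hj).1, (Finset.mem_inter.mp hj).2⟩)) (not_le.mpr h)
        · have := hinj i (hB hiB) j (hA (Finset.mem_inter.mp hj).1) h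
          exact hiA (this ▸ (Finset.mem_inter.mp hj).1)
      have hoA : (σ (A ∩ N t)).elim 0 V < V i ∧ ∀ a ∈ σ (A ∩ N t), V a < V i := by
        rcases hσ (A ∩ N t) with ⟨h0, -⟩ | ⟨a, ha, ha', -⟩
        · simpa [h0] using hV i (hB hiB)
        · simpa [ha'] using hHA a ha
      have hAa : ∀ a ∈ σ (A ∩ N t), ∀ j, V i < V j → (j ∈ A.erase a ↔ j ∈ B) := by
        intro a ha j hj
        rw [Finset.mem_erase, hAB j hj]
        refine and_iff_right ?_
        rintro rfl
        exact lt_asymm hj (hoA.2 j ha)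
      by_cases hit : i ∈ N t
      · -- `i` itself is tried, and `t` joins the collected arrivals
        have hbi : σ (B ∩ N t) = some i := by
          rcases hσ (B ∩ N t) with ⟨-, h0⟩ | ⟨b, hb, hb', hbm⟩
          · have : i ∈ B ∩ N t := Finset.mem_inter.mpr ⟨hiB, hit⟩
            simp [h0] at this
          · have h1 := hbm i (Finset.mem_inter.mpr ⟨hiB, hit⟩)
            rw [hb', hinj i (hB hiB) b (hB (Finset.mem_inter.mp hb).1)
              (le_antisymm h1 (hH b hb))]
        have htS : t ∉ S := hSL t (by simp)
        have ih1 : ∀ A : Finset I, i ∉ A → A ⊆ P → (∀ j, V i < V j → (j ∈ A ↔ j ∈ B)) →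
            (1 - p i) ^ (insert t S).card * (1 - p i * f B)
              ≤ 1 - p i * ∑ t ∈ insert t S, x t - p i * g A := by
          intro A h1 h2 h3
          refine ih hL' (fun u hu => ?_) (fun S' h => hS S' fun u hu => ?_) hiB h1 h2 hB h3
          · rw [Finset.mem_insert, not_or]
            exact ⟨fun h => htL (h ▸ hu), hSL u (by simp [hu])⟩
          · have := h u hu
            simp only [Finset.mem_insert, List.mem_cons] at this ⊢
            tauto
        rw [Finset.card_insert_of_notMem htS, Finset.sum_insert htS] at ih1
        have hf0 : f (B.erase i) = 0 :=
          chainValue_count_eq_zero hσ (d := fun _ => 1) L (Finset.notMem_erase i B)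
        rw [hbi, if_pos rfl, if_pos ⟨hit, hoA.1⟩]
        rw [show next p f B (some i) = (1 - p i) * f B by simp only [next, hf0]; ring]
        have key : (1 - p i) ^ (S.card + 1) * (1 - p i * f B)
            ≤ next p (fun A => (1 - p i * (x t + ∑ t ∈ S, x t)) + (- p i) * g A) A
              (σ (A ∩ N t)) := by
          refine le_next hp hp' ?_ fun a ha => ?_
          · linarith [ih1 A hiA hA hAB]
          · linarith [ih1 (A.erase a) (fun h => hiA (Finset.mem_of_mem_erase h)) (hAP a)
              (hAa a ha)]
        rw [next_affine, pow_succ] at key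
        linarith
      · have hbi : ∀ b ∈ σ (B ∩ N t), b ≠ i ∧ V b ≤ V i := by
          intro b hb
          rcases hσ (B ∩ N t) with ⟨h0, -⟩ | ⟨b', hb', h1, -⟩
          · simp [h0] at hb
          · rw [h1] at hb
            cases hb
            refine ⟨?_, hH b hb'⟩
            rintro rfl
            exact hit (Finset.mem_inter.mp hb').2
        have h0 : σ (B ∩ N t) ≠ some i := fun h => (hbi i h).1 rfl
        rw [if_neg h0, if_neg (fun h => hit h.1), zero_add, zero_add]
        have key : ∀ B' : Finset I, i ∈ B' → B' ⊆ P → (∀ j, V i < V j → (j ∈ B' ↔ j ∈ B)) →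
            (1 - p i) ^ S.card + (-((1 - p i) ^ S.card * p i)) * f B'
              ≤ (1 - p i * ∑ t ∈ S, x t) + (- p i) * next p g A (σ (A ∩ N t)) := by
          intro B' h1 h2 h3
          rw [← next_affine]
          refine le_next hp hp' ?_ fun a ha => ?_
          · linarith [ih0 A B' h1 hiA hA h2 fun j hj => (hAB j hj).trans (h3 j hj).symm]
          · linarith [ih0 (A.erase a) B' h1 (fun h => hiA (Finset.mem_of_mem_erase h)) (hAP a) h2
              fun j hj => (hAa a ha j hj).trans (h3 j hj).symm]
        have := next_le hp hp' (f := fun B' =>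
            (1 - p i) ^ S.card + (-((1 - p i) ^ S.card * p i)) * f B') (A := B)
          (o := σ (B ∩ N t)) (key B hiB hB fun _ _ => Iff.rfl) (fun b hb => key (B.erase b)
            (Finset.mem_erase.mpr ⟨(hbi b hb).1.symm, hiB⟩) (hBP b) fun j hj => by
              rw [Finset.mem_erase]
              refine and_iff_right ?_
              rintro rfl
              exact absurd hj (not_lt.mpr (hbi j hb).2))
        rw [next_affine] at this
        linarith

end Chain

/-! ### Tables of independent Bernoulli variables -/

section Mean

theorem weight_nonneg {I : Type*} {m : ℕ} [Fintype I] (ν : Instance I m) (x : I → Fin m → Bool) :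
    0 ≤ ∏ i, ∏ t, if x i t = true then ν.p i else 1 - ν.p i :=
  Finset.prod_nonneg fun i _ => Finset.prod_nonneg fun t _ => by
    split_ifs
    exacts [ν.p_nonneg i, sub_nonneg.mpr (ν.p_le_one i)]

variable {I : Type*} {m : ℕ}

/-- The table `x` with the entry at `(i, t)` replaced by `b`. -/
def setEntry [DecidableEq I] (x : I → Fin m → Bool) (i : I) (t : Fin m) (b : Bool) :
    I → Fin m → Bool :=
  Function.update x i (Function.update (x i) t b)

variable [DecidableEq I]

theorem setEntry_self (x : I → Fin m → Bool) (i : I) (t : Fin m) (b : Bool) :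
    setEntry x i t b i t = b := by
  simp [setEntry]

theorem setEntry_of_ne (x : I → Fin m → Bool) {i j : I} {t u : Fin m} (b : Bool)
    (h : (j, u) ≠ (i, t)) : setEntry x i t b j u = x j u := by
  unfold setEntry
  by_cases hj : j = i
  · subst hj
    have : u ≠ t := fun h' => h (by rw [h'])
    simp [this]
  · simp [hj]

variable [Fintype I]

/-- The expectation over a table of independent Bernoulli variables, those of the row `i` with
parameter `ν.p i`. -/
def Instance.mean (ν : Instance I m) (F : (I → Fin m → Bool) → ℝ) : ℝ :=
  ∑ x : I → Fin m → Bool, (∏ i, ∏ t, if x i t = true then ν.p i else 1 - ν.p i) * F x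

variable (ν : Instance I m)

theorem expectation_eq_sum_mean (F : (I → Fin m → Bool) → ℝ) :
    ν.expectation F = ∑ s, ν.joint s * ν.mean fun x => F fun i t => x i t && s t := by
  simp only [Instance.expectation, Instance.mean, Finset.mul_sum, mul_assoc]

theorem mean_mono {F G : (I → Fin m → Bool) → ℝ} (h : ∀ x, F x ≤ G x) : ν.mean F ≤ ν.mean G :=
  Finset.sum_le_sum fun x _ => mul_le_mul_of_nonneg_left (h x) (weight_nonneg ν x)

theorem mean_sum {κ : Type*} (K : Finset κ) (F : κ → (I → Fin m → Bool) → ℝ) :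
    ν.mean (fun x => ∑ k ∈ K, F k x) = ∑ k ∈ K, ν.mean (F k) := by
  simp only [Instance.mean, Finset.mul_sum]
  exact Finset.sum_comm

theorem mean_add (F G : (I → Fin m → Bool) → ℝ) :
    ν.mean (fun x => F x + G x) = ν.mean F + ν.mean G := by
  simp only [Instance.mean, mul_add, Finset.sum_add_distrib]

theorem mean_const_mul (C : ℝ) (F : (I → Fin m → Bool) → ℝ) :
    ν.mean (fun x => C * F x) = C * ν.mean F := by
  simp only [Instance.mean, Finset.mul_sum]
  exact Finset.sum_congr rfl fun x _ => by ring

theorem mean_const (C : ℝ) : ν.mean (fun _ => C) = C := by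
  have h : ∑ x : I → Fin m → Bool, (∏ i, ∏ t, if x i t = true then ν.p i else 1 - ν.p i) = 1 := by
    rw [← Fintype.prod_sum (fun (i : I) (f : Fin m → Bool) =>
      ∏ t, if f t = true then ν.p i else 1 - ν.p i)]
    refine Finset.prod_eq_one fun i _ => ?_
    rw [← Fintype.prod_sum (fun (_ : Fin m) (b : Bool) => if b = true then ν.p i else 1 - ν.p i)]
    exact Finset.prod_eq_one fun t _ => by simp
  simp only [Instance.mean, ← Finset.sum_mul, h, one_mul]

/-- Conditioning on the entry at `(i, t)`. -/
theorem mean_eq_condition (F : (I → Fin m → Bool) → ℝ) (i : I) (t : Fin m) :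
    ν.mean F = ν.p i * ν.mean (fun x => F (setEntry x i t true))
      + (1 - ν.p i) * ν.mean (fun x => F (setEntry x i t false)) := by
  set b : Bool → ℝ := fun c => if c = true then ν.p i else 1 - ν.p i with hb
  set ρ : (I → Fin m → Bool) → ℝ := fun x => (∏ u ∈ Finset.univ.erase t,
    if x i u = true then ν.p i else 1 - ν.p i) *
      ∏ j ∈ Finset.univ.erase i, ∏ u, if x j u = true then ν.p j else 1 - ν.p j with hρ
  have hw : ∀ x : I → Fin m → Bool,
      (∏ i, ∏ t, if x i t = true then ν.p i else 1 - ν.p i) = b (x i t) * ρ x := by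
    intro x
    rw [← Finset.mul_prod_erase _ _ (Finset.mem_univ i),
      ← Finset.mul_prod_erase _ _ (Finset.mem_univ t), hρ, hb, mul_assoc]
  have hρ' : ∀ x c, ρ (setEntry x i t c) = ρ x := by
    intro x c
    simp only [hρ]
    congr 1
    · refine Finset.prod_congr rfl fun u hu => ?_
      rw [setEntry_of_ne]
      simpa using Finset.ne_of_mem_erase hu
    · refine Finset.prod_congr rfl fun j hj => Finset.prod_congr rfl fun u _ => ?_
      rw [setEntry_of_ne]
      exact fun h => Finset.ne_of_mem_erase hj (Prod.ext_iff.mp h).1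
  have hflip : ∀ G : (I → Fin m → Bool) → ℝ,
      ∑ x, G x = ∑ x, G (setEntry x i t (!(x i t))) := by
    intro G
    refine (Finset.sum_nbij' (fun x => setEntry x i t (!(x i t)))
      (fun x => setEntry x i t (!(x i t))) (by simp) (by simp) ?_ ?_ (by simp)).symm <;>
    · intro x _
      funext j u
      by_cases h : (j, u) = (i, t)
      · obtain ⟨rfl, rfl⟩ := Prod.ext_iff.mp h
        simp [setEntry_self]
      · rw [setEntry_of_ne _ _ h, setEntry_of_ne _ _ h]
  have hself : ∀ x : I → Fin m → Bool, setEntry x i t (x i t) = x := by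
    intro x
    funext j u
    by_cases h : (j, u) = (i, t)
    · obtain ⟨rfl, rfl⟩ := Prod.ext_iff.mp h
      simp [setEntry_self]
    · rw [setEntry_of_ne _ _ h]
  have hset : ∀ (x : I → Fin m → Bool) (c c' : Bool),
      setEntry (setEntry x i t c) i t c' = setEntry x i t c' := by
    intro x c c'
    funext j u
    by_cases h : (j, u) = (i, t)
    · obtain ⟨rfl, rfl⟩ := Prod.ext_iff.mp h
      simp [setEntry_self]
    · rw [setEntry_of_ne _ _ h, setEntry_of_ne _ _ h, setEntry_of_ne _ _ h]
  -- every table arises from two tables when the entry at `(i, t)` is overwritten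
  have hsum : ∀ G : (I → Fin m → Bool) → ℝ, 2 * ∑ x, G x
      = ∑ x, (G (setEntry x i t true) + G (setEntry x i t false)) := by
    intro G
    rw [two_mul]
    nth_rw 2 [hflip G]
    rw [← Finset.sum_add_distrib]
    refine Finset.sum_congr rfl fun x _ => ?_
    have := hself x
    cases h : x i t
    · rw [h] at this
      simp only [Bool.not_false]
      nth_rw 1 [← this]
      ring
    · rw [h] at this
      simp only [Bool.not_true]
      nth_rw 1 [← this]
  have h2 : ∀ G : (I → Fin m → Bool) → ℝ, 2 * ν.mean G
      = ∑ x, ρ x * (ν.p i * G (setEntry x i t true) + (1 - ν.p i) * G (setEntry x i t false)) := by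
    intro G
    simp only [Instance.mean, hw]
    rw [hsum]
    refine Finset.sum_congr rfl fun x _ => ?_
    simp only [hρ', setEntry_self, hb]
    simp
    ring
  have h3 := h2 F
  have h4 := h2 fun x => F (setEntry x i t true)
  have h5 := h2 fun x => F (setEntry x i t false)
  simp only [hset] at h4 h5
  have : ∑ x, ρ x * (ν.p i * F (setEntry x i t true) + (1 - ν.p i) * F (setEntry x i t false))
      = ν.p i * ∑ x, ρ x * (ν.p i * F (setEntry x i t true) + (1 - ν.p i) * F (setEntry x i t true))
      + (1 - ν.p i) * ∑ x, ρ x *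
        (ν.p i * F (setEntry x i t false) + (1 - ν.p i) * F (setEntry x i t false)) := by
    simp only [Finset.mul_sum, ← Finset.sum_add_distrib]
    exact Finset.sum_congr rfl fun x _ => by ring
  rw [← h3, ← h4, ← h5] at this
  linarith

/-- The probability that all entries of the row `i` with column in `S` are zero. -/
theorem mean_forall_false (i : I) (S : Finset (Fin m)) :
    ν.mean (fun x => if ∀ t ∈ S, x i t = false then 1 else 0) = (1 - ν.p i) ^ S.card := by
  induction S using Finset.induction_on with
  | empty => simpa using mean_const ν 1
  | insert t S ht ih =>
    have h : ∀ x c, (∀ u ∈ S, setEntry x i t c i u = false) ↔ ∀ u ∈ S, x i u = false := by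
      intro x c
      refine forall₂_congr fun u hu => ?_
      rw [setEntry_of_ne]
      rintro ⟨⟩
      exact ht hu
    rw [mean_eq_condition ν _ i t, Finset.card_insert_of_notMem ht, pow_succ, ← ih]
    have h0 := mean_const ν 0
    simp [setEntry_self, h, h0]
    ring

end Mean

/-! ### Offline algorithms -/

section Offline

variable {I : Type*} {m : ℕ} {ν : Instance I m} (A : OfflineAlgorithm ν) (z : A.Seed)

theorem run_succ_of_none {w : I → Fin m → Bool} {k : ℕ} (h : A.act z (A.run z w k) = none) :
    A.run z w (k + 1) = A.run z w k := by
  simp [OfflineAlgorithm.run, h]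

theorem run_succ_of_some {w : I → Fin m → Bool} {k : ℕ} {i : I} {t : Fin m}
    (h : A.act z (A.run z w k) = some (i, t)) :
    A.run z w (k + 1) = ((i, t), w i t) :: A.run z w k := by
  simp [OfflineAlgorithm.run, h]

/-- The properties of a history that every execution with the outcomes `w` has. -/
structure ValidHistory (ν : Instance I m) (w : I → Fin m → Bool) (h : History I m) : Prop where
  outcome : ∀ e ∈ h, e.2 = w e.1.1 e.1.2
  edge : ∀ e ∈ h, e.1.1 ∈ ν.nbr e.1.2
  nodup : (h.map fun e => e.1.2).Nodup
  success : ∀ i t t', ((i, t), true) ∈ h → ((i, t'), true) ∈ h → t = t'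

theorem validHistory_run (w : I → Fin m → Bool) (k : ℕ) : ValidHistory ν w (A.run z w k) := by
  induction k with
  | zero => constructor <;> simp [OfflineAlgorithm.run]
  | succ k ih =>
    cases h : A.act z (A.run z w k) with
    | none => rwa [run_succ_of_none A z h]
    | some e =>
      obtain ⟨i, t⟩ := e
      rw [run_succ_of_some A z h]
      have h1 := A.edge z _ i t h
      have h2 := A.available z _ i t h
      have h3 := A.unmatched z _ i t h
      refine ⟨?_, ?_, ?_, ?_⟩
      · intro e he
        rcases List.mem_cons.mp he with rfl | he
        exacts [rfl, ih.outcome e he]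
      · intro e he
        rcases List.mem_cons.mp he with rfl | he
        exacts [h1, ih.edge e he]
      · simp only [List.map_cons, List.nodup_cons]
        refine ⟨?_, ih.nodup⟩
        rw [List.mem_map]
        rintro ⟨⟨⟨j, u⟩, b⟩, hm, rfl⟩
        exact h3 j b hm
      · intro j u u' hu hu'
        rw [List.mem_cons] at hu hu'
        rcases hu with hu | hu <;> rcases hu' with hu' | hu'
        · simp only [Prod.mk.injEq] at hu hu'
          rw [hu.1.2, hu'.1.2]
        · simp only [Prod.mk.injEq] at hu
          exact absurd (hu.1.1 ▸ hu') (h2 u')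
        · simp only [Prod.mk.injEq] at hu'
          exact absurd (hu'.1.1 ▸ hu) (h2 u)
        · exact ih.success j u u' hu hu'

/-- The edge `(i, t)` is included in the matching. -/
def Tried (h : History I m) (i : I) (t : Fin m) : Prop := ∃ b, ((i, t), b) ∈ h

/-- Whether the edge `(i, t)` is ever included does not depend on its own outcome. -/
theorem tried_run_iff {w w' : I → Fin m → Bool} {i : I} {t : Fin m}
    (h : ∀ j u, (j, u) ≠ (i, t) → w j u = w' j u) (k : ℕ) :
    Tried (A.run z w k) i t ↔ Tried (A.run z w' k) i t := by
  have key : (Tried (A.run z w k) i t ∧ Tried (A.run z w' k) i t) ∨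
      (¬ Tried (A.run z w k) i t ∧ A.run z w k = A.run z w' k) := by
    have mono : ∀ w k, Tried (A.run z w k) i t → Tried (A.run z w (k + 1)) i t := by
      rintro w k ⟨b, hb⟩
      cases h' : A.act z (A.run z w k) with
      | none => exact ⟨b, by rwa [run_succ_of_none A z h']⟩
      | some e => exact ⟨b, by rw [run_succ_of_some A z h']; exact List.mem_cons_of_mem _ hb⟩
    induction k with
    | zero => exact Or.inr ⟨by simp [Tried, OfflineAlgorithm.run], rfl⟩
    | succ k ih =>
      rcases ih with ⟨h1, h2⟩ | ⟨h1, h2⟩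
      · exact Or.inl ⟨mono _ _ h1, mono _ _ h2⟩
      · cases h' : A.act z (A.run z w k) with
        | none =>
          have h'' := h'
          rw [h2] at h''
          rw [run_succ_of_none A z h', run_succ_of_none A z h'']
          exact Or.inr ⟨h1, h2⟩
        | some e =>
          have h'' := h'
          rw [h2] at h''
          obtain ⟨j, u⟩ := e
          rw [run_succ_of_some A z h', run_succ_of_some A z h'']
          by_cases he : (j, u) = (i, t)
          · rw [he]
            exact Or.inl ⟨⟨_, List.mem_cons_self⟩, ⟨_, List.mem_cons_self⟩⟩
          · refine Or.inr ⟨?_, by rw [h2, h j u he]⟩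
            rintro ⟨b, hb⟩
            rw [List.mem_cons] at hb
            rcases hb with hb | hb
            · exact he (Prod.ext_iff.mp hb).1.symm
            · exact h1 ⟨b, hb⟩
  rcases key with ⟨h1, h2⟩ | ⟨-, h2⟩
  · exact iff_of_true h1 h2
  · rw [h2]

variable [Fintype I] [DecidableEq I]

open Classical in
/-- The reward of a valid history as a sum over all edges. -/
theorem ValidHistory.reward_eq {w : I → Fin m → Bool} {h : History I m}
    (hv : ValidHistory ν w h) :
    ν.reward h = ∑ i, ∑ t, if ((i, t), true) ∈ h then ν.r i else 0 := by
  have hnd : h.Nodup := hv.nodup.of_map _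
  have h1 : ν.reward h = ∑ e ∈ h.toFinset, if e.2 = true then ν.r e.1.1 else 0 := by
    rw [List.sum_toFinset _ hnd]
    rfl
  have h2 : ∑ e ∈ h.toFinset, (if e.2 = true then ν.r e.1.1 else 0)
      = ∑ e : (I × Fin m) × Bool, if e ∈ h ∧ e.2 = true then ν.r e.1.1 else 0 := by
    rw [← Finset.sum_filter, ← Finset.sum_filter]
    refine Finset.sum_congr ?_ fun _ _ => rfl
    ext e
    simp
  rw [h1, h2, Fintype.sum_prod_type, Fintype.sum_prod_type]
  simp

open Classical in
/-- The probability that the edge `(i, t)` is included in the matching and `s t = 1`, when the seed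
is `z` and the arrival variables are given by `s`. -/
def tryProb (s : Fin m → Bool) (i : I) (t : Fin m) : ℝ :=
  if s t = true then
    ν.mean fun x => if Tried (A.run z (fun i t => x i t && s t) m) i t then 1 else 0
  else 0

variable (s : Fin m → Bool)

theorem tryProb_nonneg (i : I) (t : Fin m) : 0 ≤ tryProb A z s i t := by
  unfold tryProb
  split_ifs
  · refine (mean_const ν 0).ge.trans (mean_mono ν fun x => ?_)
    split_ifs <;> norm_num
  · exact le_rfl

theorem tryProb_eq_zero {i : I} {t : Fin m} (hi : i ∉ ν.nbr t) : tryProb A z s i t = 0 := by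
  unfold tryProb
  split_ifs
  · refine Eq.trans (congrArg ν.mean (funext fun x => if_neg ?_)) (mean_const ν 0)
    rintro ⟨b, hb⟩
    exact hi ((validHistory_run A z _ m).edge _ hb)
  · rfl

open Classical in
theorem sum_tryProb_le_one (t : Fin m) : ∑ i, tryProb A z s i t ≤ 1 := by
  unfold tryProb
  split_ifs
  · rw [← mean_sum]
    refine (mean_mono ν fun x => ?_).trans (mean_const ν 1).le
    rw [Finset.sum_boole]
    norm_cast
    refine Finset.card_le_one.mpr fun i hi j hj => ?_
    obtain ⟨b, hb⟩ := (Finset.mem_filter.mp hi).2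
    obtain ⟨c, hc⟩ := (Finset.mem_filter.mp hj).2
    have := List.inj_on_of_nodup_map (validHistory_run A z (fun i t => x i t && s t) m).nodup
      hb hc rfl
    exact (Prod.ext_iff.mp (Prod.ext_iff.mp this).1).1
  · simp

open Classical in
/-- An edge that is included succeeds with its own probability, whatever the algorithm has observed
before. -/
theorem mean_success (i : I) (t : Fin m) :
    ν.mean (fun x => if ((i, t), true) ∈ A.run z (fun i t => x i t && s t) m then 1 else 0)
      = ν.p i * tryProb A z s i t := by
  unfold tryProb
  have hiff : ∀ x : I → Fin m → Bool, ((i, t), true) ∈ A.run z (fun i t => x i t && s t) m ↔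
      Tried (A.run z (fun i t => x i t && s t) m) i t ∧ (x i t && s t) = true := by
    intro x
    have hv := validHistory_run A z (fun i t => x i t && s t) m
    constructor
    · exact fun h => ⟨⟨_, h⟩, (hv.outcome _ h).symm⟩
    · rintro ⟨⟨b, hb⟩, h⟩
      have : b = (x i t && s t) := hv.outcome _ hb
      rwa [this, h] at hb
  simp only [hiff]
  split_ifs with hs
  · rw [mean_eq_condition ν _ i t]
    have h1 : ∀ x c, Tried (A.run z (fun i' t' => setEntry x i t c i' t' && s t') m) i t ↔
        Tried (A.run z (fun i t => x i t && s t) m) i t := fun x c =>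
      tried_run_iff A z (fun j u h => by rw [setEntry_of_ne _ _ h]) m
    have h0 := mean_const ν 0
    simp [setEntry_self, hs, h1, h0]
  · have h0 := mean_const ν 0
    simp [hs, h0]

/-- Some attempt at `i` among the arrivals in `S` succeeds only if one of the `|S|` Bernoulli
variables of these edges is one. -/
theorem sum_tryProb_le_pow (i : I) {S : Finset (Fin m)} :
    ν.p i * ∑ t ∈ S, tryProb A z s i t ≤ 1 - (1 - ν.p i) ^ S.card := by
  classical
  rw [Finset.mul_sum]
  simp only [← mean_success]
  rw [← mean_sum, ← mean_forall_false, le_sub_iff_add_le, ← mean_add]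
  refine (mean_mono ν fun x => ?_).trans (mean_const ν 1).le
  have hv := validHistory_run A z (fun i t => x i t && s t) m
  rw [Finset.sum_boole]
  split_ifs with h
  · rw [Finset.card_eq_zero.mpr]
    · simp
    · refine Finset.filter_eq_empty_iff.mpr fun t ht hm => ?_
      have : true = (x i t && s t) := hv.outcome _ hm
      simp [h t ht] at this
  · rw [add_zero]
    norm_cast
    exact Finset.card_le_one.mpr fun t ht u hu =>
      hv.success i t u (Finset.mem_filter.mp ht).2 (Finset.mem_filter.mp hu).2

theorem mean_reward_run :
    ν.mean (fun x => ν.reward (A.run z (fun i t => x i t && s t) m))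
      = ∑ i, ∑ t, ν.p i * ν.r i * tryProb A z s i t := by
  classical
  simp only [(validHistory_run A z _ m).reward_eq, mean_sum]
  refine Finset.sum_congr rfl fun i _ => Finset.sum_congr rfl fun t _ => ?_
  rw [mul_right_comm, ← mean_success, mul_comm, ← mean_const_mul]
  simp

end Offline

/-! ### Perturbed Greedy as a Markov chain -/

section Greedy

variable {I : Type*} {m : ℕ}

/-- The quantity by which Perturbed Greedy ranks the resources, without the factor `Pr[s_t = 1]`
that the neighbours of an arrival have in common. -/
def rankValue (ν : Instance I m) (y : I → ℝ) (i : I) : ℝ :=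
  ν.p i * ν.r i * (1 - Real.exp (y i - 1))

/-- The resources that contribute to the reward. -/
def profitable [Fintype I] (ν : Instance I m) : Finset I :=
  Finset.univ.filter fun i => 0 < ν.p i * ν.r i

/-- The seeds give the profitable resources distinct positive ranks. -/
structure Generic [Fintype I] (ν : Instance I m) (y : I → ℝ) : Prop where
  pos : ∀ i ∈ profitable ν, 0 < rankValue ν y i
  inj : ∀ i ∈ profitable ν, ∀ j ∈ profitable ν, rankValue ν y i = rankValue ν y j → i = j

/-- The relation between the ranks of two resources. -/
def rankLE (ν : Instance I m) (y : I → ℝ) (k j : I) : Prop := rankValue ν y k ≤ rankValue ν y j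

theorem selects_rank (ν : Instance I m) (y : I → ℝ) :
    Selects (rankValue ν y) (best (rankLE ν y)) :=
  selects_best _

theorem mul_reward_nonneg (ν : Instance I m) (i : I) : 0 ≤ ν.p i * ν.r i :=
  mul_nonneg (ν.p_nonneg i) (ν.r_nonneg i)

theorem mul_reward_eq_zero [Fintype I] {ν : Instance I m} {i : I} (hi : i ∉ profitable ν) :
    ν.p i * ν.r i = 0 := by
  refine le_antisymm ?_ (mul_reward_nonneg ν i)
  simpa [profitable] using hi

/-- One step of the execution of Perturbed Greedy. -/
def greedyStep (ν : Instance I m) (tie : TieBreak I m) (y : I → ℝ) (w : I → Fin m → Bool)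
    (h : History I m) (t : Fin m) : History I m :=
  match greedyOffer tie ν.r y h t (ν.nbr t) (fun i => ν.edgeProb i t) with
  | none => h
  | some i => ((i, t), w i t) :: h

theorem foldl_greedyStep_congr (ν : Instance I m) (tie : TieBreak I m) (y : I → ℝ)
    {w w' : I → Fin m → Bool} {L : List (Fin m)} (hw : ∀ t ∈ L, ∀ i, w i t = w' i t)
    (h : History I m) :
    L.foldl (greedyStep ν tie y w) h = L.foldl (greedyStep ν tie y w') h := by
  induction L generalizing h with
  | nil => rfl
  | cons t L ih =>
    have : greedyStep ν tie y w h t = greedyStep ν tie y w' h t := by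
      unfold greedyStep
      split
      · rfl
      · rw [hw t (by simp)]
    rw [List.foldl_cons, List.foldl_cons, this, ih fun u hu => hw u (by simp [hu])]

theorem available_cons_true {h : History I m} {i j : I} {t : Fin m} :
    Available (((i, t), true) :: h) j ↔ j ≠ i ∧ Available h j := by
  unfold Available
  constructor
  · refine fun H => ⟨?_, fun u hu => H u (List.mem_cons_of_mem _ hu)⟩
    rintro rfl
    exact H t List.mem_cons_self
  · rintro ⟨hne, H⟩ u hu
    rcases List.mem_cons.mp hu with hu | hu
    · exact hne (Prod.ext_iff.mp (Prod.ext_iff.mp hu).1).1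
    · exact H u hu

theorem available_cons_false {h : History I m} {i j : I} {t : Fin m} :
    Available (((i, t), false) :: h) j ↔ Available h j := by
  unfold Available
  simp

theorem mem_maximizers {f : I → ℝ} {A : Finset I} {i : I} :
    i ∈ maximizers f A ↔ i ∈ A ∧ ∀ j ∈ A, f j ≤ f i :=
  Finset.mem_filter

variable [Fintype I] (ν : Instance I m) (tie : TieBreak I m)

open Classical in
/-- The profitable resources that are available. -/
def availableProfitable (h : History I m) : Finset I :=
  (profitable ν).filter fun i => Available h i

theorem mem_availableProfitable {ν : Instance I m} {h : History I m} {i : I} :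
    i ∈ availableProfitable ν h ↔ i ∈ profitable ν ∧ Available h i := by
  simp [availableProfitable]

theorem availableProfitable_cons_true [DecidableEq I] (h : History I m) (i : I) (t : Fin m) :
    availableProfitable ν (((i, t), true) :: h) = (availableProfitable ν h).erase i := by
  ext j
  simp only [mem_availableProfitable, Finset.mem_erase, available_cons_true]
  tauto

theorem availableProfitable_cons_false (h : History I m) (i : I) (t : Fin m) :
    availableProfitable ν (((i, t), false) :: h) = availableProfitable ν h := by
  ext j
  simp only [mem_availableProfitable, available_cons_false]

variable {ν} [DecidableEq I]

/-- Without ties among the profitable resources, the tie-breaking rule only matters when no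
profitable neighbour is available. -/
theorem greedyOffer_cases {y : I → ℝ} (hy : Generic ν y) {t : Fin m} (ht : 0 < ν.arrivalProb t)
    (h : History I m) :
    (∃ a, best (rankLE ν y) (availableProfitable ν h ∩ ν.nbr t) = some a ∧
      greedyOffer tie ν.r y h t (ν.nbr t) (fun i => ν.edgeProb i t) = some a) ∨
    (best (rankLE ν y) (availableProfitable ν h ∩ ν.nbr t) = none ∧
      ∀ j, greedyOffer tie ν.r y h t (ν.nbr t) (fun i => ν.edgeProb i t) = some j →
        j ∉ profitable ν) := by
  classical
  have hoffer : ∀ j, greedyOffer tie ν.r y h t (ν.nbr t) (fun i => ν.edgeProb i t) = some j →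
      j ∈ ν.nbr t ∧ Available h j ∧
        ∀ k ∈ ν.nbr t, Available h k → rankValue ν y k ≤ rankValue ν y j := by
    intro j hj
    unfold greedyOffer at hj
    split_ifs at hj with hA
    have hmem : ∀ (B : Finset I) (hB : B.Nonempty), (tie h t B hB).1 = j → j ∈ B :=
      fun B hB hj => hj ▸ (tie h t B hB).2
    obtain ⟨h1, h2⟩ := mem_maximizers.mp (hmem _ _ (Option.some.inj hj))
    refine ⟨(Finset.mem_filter.mp h1).1, (Finset.mem_filter.mp h1).2, fun k hk hk' => ?_⟩
    have h3 := h2 k (Finset.mem_filter.mpr ⟨hk, hk'⟩)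
    have h4 : ∀ i, ν.edgeProb i t * ν.r i * (1 - Real.exp (y i - 1))
        = ν.arrivalProb t * rankValue ν y i := by
      intro i
      simp only [Instance.edgeProb, rankValue]
      ring
    simp only [h4] at h3
    exact le_of_mul_le_mul_left h3 ht
  rcases selects_rank ν y (availableProfitable ν h ∩ ν.nbr t) with ⟨h0, h1⟩ | ⟨a, ha, h0, h1⟩
  · refine Or.inr ⟨h0, fun j hj hjP => ?_⟩
    have : j ∈ availableProfitable ν h ∩ ν.nbr t := Finset.mem_inter.mpr
      ⟨Finset.mem_filter.mpr ⟨hjP, (hoffer j hj).2.1⟩, (hoffer j hj).1⟩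
    simp [h1] at this
  · refine Or.inl ⟨a, h0, ?_⟩
    obtain ⟨ha1, ha2⟩ := Finset.mem_inter.mp ha
    obtain ⟨haP, haA⟩ := Finset.mem_filter.mp ha1
    obtain ⟨j, hj⟩ : ∃ j, greedyOffer tie ν.r y h t (ν.nbr t) (fun i => ν.edgeProb i t)
        = some j := by
      unfold greedyOffer
      rw [dif_pos ⟨a, Finset.mem_filter.mpr ⟨ha2, haA⟩⟩]
      exact ⟨_, rfl⟩
    obtain ⟨hj1, hj2, hj3⟩ := hoffer j hj
    have hjP : j ∈ profitable ν := by
      by_contra hjP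
      have h2 := (hy.pos a haP).trans_le (hj3 a ha2 haA)
      rw [rankValue, mul_reward_eq_zero hjP, zero_mul] at h2
      exact lt_irrefl _ h2
    have h2 := h1 j (Finset.mem_inter.mpr ⟨Finset.mem_filter.mpr ⟨hjP, hj2⟩, hj1⟩)
    rw [hj, hy.inj a haP j hjP (le_antisymm (hj3 a ha2 haA) h2)]

/-- For fixed arrival variables `s` and generic seeds, the expected reward of Perturbed Greedy is
the value of the chain of available profitable resources. Arrivals with `s t = 0` and unprofitable
resources leave no trace. -/
theorem mean_reward_foldl {y : I → ℝ} (hy : Generic ν y) {s : Fin m → Bool}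
    (hs : ∀ t, s t = true → 0 < ν.arrivalProb t) {L : List (Fin m)} (hL : L.Nodup)
    (h : History I m) :
    ν.mean (fun x => ν.reward (L.foldl (greedyStep ν tie y fun i t => x i t && s t) h))
      = ν.reward h + chainValue ν.p ν.nbr (best (rankLE ν y))
        (fun _ o => o.elim 0 fun i => ν.p i * ν.r i) (L.filter fun t => s t)
        (availableProfitable ν h) := by
  induction L generalizing h with
  | nil => simpa [chainValue] using mean_const ν (ν.reward h)
  | cons t L ih =>
    obtain ⟨htL, hL'⟩ := List.nodup_cons.mp hL
    have hrf : ∀ i, ν.reward (((i, t), false) :: h) = ν.reward h := by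
      simp [Instance.reward]
    have hrt : ∀ i, ν.reward (((i, t), true) :: h) = ν.r i + ν.reward h := by
      simp [Instance.reward]
    simp only [List.foldl_cons]
    set o := greedyOffer tie ν.r y h t (ν.nbr t) (fun i => ν.edgeProb i t) with ho
    have hnone : o = none → ∀ x : I → Fin m → Bool,
        greedyStep ν tie y (fun i t => x i t && s t) h t = h := by
      intro h0 x
      simp [greedyStep, ← ho, h0]
    have hsome : ∀ i, o = some i →
        ν.mean (fun x => ν.reward (L.foldl (greedyStep ν tie y fun i t => x i t && s t)
          (greedyStep ν tie y (fun i t => x i t && s t) h t)))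
        = ν.p i * ν.mean (fun x => ν.reward (L.foldl (greedyStep ν tie y fun i t => x i t && s t)
            (((i, t), s t) :: h)))
        + (1 - ν.p i) * ν.mean (fun x => ν.reward (L.foldl
            (greedyStep ν tie y fun i t => x i t && s t) (((i, t), false) :: h))) := by
      intro i hi
      have h1 : ∀ x : I → Fin m → Bool, greedyStep ν tie y (fun i t => x i t && s t) h t
          = ((i, t), x i t && s t) :: h := by
        intro x
        simp [greedyStep, ← ho, hi]
      have h2 : ∀ (x : I → Fin m → Bool) (c : Bool) (h' : History I m),
          L.foldl (greedyStep ν tie y fun i' t' => setEntry x i t c i' t' && s t') h'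
            = L.foldl (greedyStep ν tie y fun i t => x i t && s t) h' := by
        intro x c h'
        refine foldl_greedyStep_congr ν tie y (fun u hu j => ?_) h'
        rw [setEntry_of_ne]
        rintro ⟨⟩
        exact htL hu
      simp only [h1]
      rw [mean_eq_condition ν _ i t]
      simp only [h2, setEntry_self, Bool.true_and, Bool.false_and]
    cases hst : s t with
    | false =>
      rw [List.filter_cons_of_neg (by simp [hst])]
      cases h0 : o with
      | none => simp only [hnone h0, ih hL']
      | some i =>
        rw [hsome i h0, hst]
        simp only [ih hL', hrf, availableProfitable_cons_false]
        ring
    | true =>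
      rw [List.filter_cons_of_pos (by simp [hst])]
      simp only [chainValue]
      rcases greedyOffer_cases tie hy (hs t hst) h with ⟨a, ha, ha'⟩ | ⟨ha, ha'⟩
      · rw [hsome a ha', hst, ha]
        simp only [ih hL', hrf, hrt, availableProfitable_cons_false, availableProfitable_cons_true,
          next, Option.elim]
        ring
      · rw [ha]
        cases h0 : o with
        | none => simp only [hnone h0, ih hL', next, Option.elim, zero_add]
        | some i =>
          have hi : i ∉ profitable ν := ha' i h0
          have hi' : i ∉ availableProfitable ν h := fun h' => hi (mem_availableProfitable.mp h').1
          rw [hsome i h0, hst]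
          simp only [ih hL', hrf, hrt, availableProfitable_cons_false,
            availableProfitable_cons_true, next, Option.elim, zero_add,
            Finset.erase_eq_of_notMem hi']
          linear_combination mul_reward_eq_zero hi

theorem mean_reward_greedyRun {y : I → ℝ} (hy : Generic ν y) {s : Fin m → Bool}
    (hs : ∀ t, s t = true → 0 < ν.arrivalProb t) :
    ν.mean (fun x => ν.reward (ν.greedyRun tie y fun i t => x i t && s t))
      = chainValue ν.p ν.nbr (best (rankLE ν y)) (fun _ o => o.elim 0 fun i => ν.p i * ν.r i)
        ((List.finRange m).filter fun t => s t) (profitable ν) := by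
  have h := mean_reward_foldl tie hy hs (List.nodup_finRange m) []
  have h0 : availableProfitable ν [] = profitable ν := by
    ext i
    simp [availableProfitable, Available]
  rw [h0, show ν.reward ([] : History I m) = 0 by simp [Instance.reward], zero_add] at h
  exact h

end Greedy

/-! ### Uniform seeds -/

section Seeds

/-- The uniform distribution on `[0,1]`. -/
abbrev uniform01 : Measure ℝ := (volume : Measure ℝ).restrict (Set.Icc 0 1)

instance : IsProbabilityMeasure uniform01 := ⟨by simp [uniform01]⟩

/-- The distribution of the seeds. -/
abbrev seedLaw (I : Type*) [Fintype I] : Measure (I → ℝ) := Measure.pi fun _ : I => uniform01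

/-- Resampling a coordinate of a product measure preserves it. -/
theorem measurePreserving_update {I : Type*} [Fintype I] [DecidableEq I] (i : I) :
    MeasurePreserving (fun z : (I → ℝ) × ℝ => Function.update z.1 i z.2)
      ((seedLaw I).prod uniform01) (seedLaw I) := by
  have hm : Measurable fun z : (I → ℝ) × ℝ => Function.update z.1 i z.2 := by
    rw [measurable_pi_iff]
    intro j
    by_cases hj : j = i
    · subst hj
      simpa using measurable_snd
    · simp only [Function.update_of_ne hj]
      exact (measurable_pi_apply j).comp measurable_fst
  refine ⟨hm, (Measure.pi_eq fun s hs => ?_).symm⟩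
  rw [Measure.map_apply hm (MeasurableSet.univ_pi hs)]
  have : (fun z : (I → ℝ) × ℝ => Function.update z.1 i z.2) ⁻¹' Set.univ.pi s
      = (Set.univ.pi (Function.update s i Set.univ)) ×ˢ s i := by
    ext z
    simp only [Set.mem_preimage, Set.mem_pi, Set.mem_univ, true_imp_iff, Set.mem_prod]
    constructor
    · intro h
      refine ⟨fun j => ?_, by simpa using h i⟩
      by_cases hj : j = i
      · subst hj; simp
      · simpa [hj] using h j
    · rintro ⟨h1, h2⟩ j
      by_cases hj : j = i
      · subst hj; simpa using h2
      · simpa [hj] using h1 j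
  rw [this, Measure.prod_prod, Measure.pi_pi, ← Finset.mul_prod_erase _ _ (Finset.mem_univ i),
    ← Finset.mul_prod_erase Finset.univ (fun j => uniform01 (s j)) (Finset.mem_univ i)]
  simp only [Function.update_self, measure_univ, one_mul]
  rw [mul_comm]
  congr 1
  refine Finset.prod_congr rfl fun j hj => ?_
  rw [Function.update_of_ne (Finset.ne_of_mem_erase hj)]

theorem ae_seed_mem (I : Type*) [Fintype I] : ∀ᵐ y ∂seedLaw I, ∀ i, 0 ≤ y i ∧ y i < 1 := by
  rw [ae_all_iff]
  intro i
  have h : ∀ᵐ u ∂uniform01, 0 ≤ u ∧ u < 1 := by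
    have h1 : ∀ᵐ u ∂uniform01, u ≠ 1 :=
      compl_mem_ae_iff.mpr (Set.subsingleton_singleton.measure_zero _)
    filter_upwards [h1, ae_restrict_mem measurableSet_Icc] with u hu hu'
    exact ⟨hu'.1, lt_of_le_of_ne hu'.2 hu⟩
  exact (Measure.tendsto_eval_ae_ae (μ := fun _ : I => uniform01) (i := i)).eventually h

variable {I : Type*} {m : ℕ}

theorem measurable_rankValue (ν : Instance I m) (i : I) :
    Measurable fun y : I → ℝ => rankValue ν y i := by
  unfold rankValue
  fun_prop

theorem measurable_rankLE (ν : Instance I m) : Measurable (rankLE ν) := by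
  rw [measurable_pi_iff]
  intro k
  rw [measurable_pi_iff]
  intro j
  exact (measurableSet_le (measurable_rankValue ν k) (measurable_rankValue ν j)).mem

theorem ae_generic [Fintype I] (ν : Instance I m) : ∀ᵐ y ∂seedLaw I, Generic ν y := by
  classical
  have hinj : ∀ᵐ y ∂seedLaw I, ∀ i j, i ∈ profitable ν → i ≠ j →
      rankValue ν y i ≠ rankValue ν y j := by
    simp only [ae_all_iff]
    intro i j hi hij
    have hms : MeasurableSet {y : I → ℝ | rankValue ν y i ≠ rankValue ν y j} :=
      (measurableSet_eq_fun (measurable_rankValue ν i) (measurable_rankValue ν j)).compl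
    rw [← (measurePreserving_update (I := I) i).map_eq,
      ae_map_iff (measurePreserving_update i).measurable.aemeasurable hms]
    refine (Measure.ae_prod_iff_ae_ae ((measurePreserving_update i).measurable hms)).mpr ?_
    refine Filter.Eventually.of_forall fun y => ?_
    have hsub : {u : ℝ | rankValue ν (Function.update y i u) i
        = rankValue ν (Function.update y i u) j}.Subsingleton := by
      intro u hu u' hu'
      have hR : 0 < ν.p i * ν.r i := by simpa [profitable] using hi
      simp only [rankValue, Set.mem_ofPred_eq, Function.update_self,
        Function.update_of_ne hij.symm] at hu hu'
      have h := hu.trans hu'.symm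
      have h1 := mul_left_cancel₀ hR.ne' h
      have h2 : Real.exp (u - 1) = Real.exp (u' - 1) := by linarith
      have h3 := Real.exp_injective h2
      linarith
    exact compl_mem_ae_iff.mpr (hsub.measure_zero _)
  filter_upwards [hinj, ae_seed_mem I] with y h1 h2
  refine ⟨fun i hi => ?_, fun i hi j _ h => by_contra fun hij => h1 i j hi hij h⟩
  have hR : 0 < ν.p i * ν.r i := by simpa [profitable] using hi
  refine mul_pos hR ?_
  rw [sub_pos, Real.exp_lt_one_iff]
  linarith [(h2 i).2]

/-- A lower bound for what an edge of a resource with weight `R` and seed `u` yields, when the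
arrival would receive `v` in the absence of the resource: `v` itself, and the resource's share
`R * exp (u - 1)` of the weight if the resource outranks `v`. -/
def payoff (R v u : ℝ) : ℝ :=
  v + R * Real.exp (u - 1) * if v < R * (1 - Real.exp (u - 1)) then 1 else 0

theorem measurable_payoff (R : ℝ) : Measurable fun z : ℝ × ℝ => payoff R z.1 z.2 := by
  unfold payoff
  refine measurable_fst.add (Measurable.mul (by fun_prop) (Measurable.ite ?_ (by fun_prop)
    (by fun_prop)))
  exact measurableSet_lt measurable_fst (by fun_prop)

theorem abs_payoff_le {R v u : ℝ} (hu : u ≤ 1) : |payoff R v u| ≤ |v| + |R| := by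
  unfold payoff
  refine (abs_add_le _ _).trans (add_le_add_right ?_ _)
  rw [abs_mul, abs_mul, Real.abs_exp]
  have h1 : Real.exp (u - 1) ≤ 1 := Real.exp_le_one_iff.mpr (by linarith)
  have h2 : |if v < R * (1 - Real.exp (u - 1)) then (1 : ℝ) else 0| ≤ 1 := by
    split_ifs <;> simp
  calc |R| * Real.exp (u - 1) * |if v < R * (1 - Real.exp (u - 1)) then (1 : ℝ) else 0|
      ≤ |R| * 1 * 1 := by gcongr
    _ = |R| := by ring

theorem integrable_payoff (R v : ℝ) : Integrable (payoff R v) uniform01 := by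
  refine Integrable.of_bound
    ((measurable_payoff R).comp (measurable_const.prodMk measurable_id)).aestronglyMeasurable
    (|v| + |R|) ?_
  filter_upwards [ae_restrict_mem measurableSet_Icc] with u hu
  exact abs_payoff_le hu.2

/-- The choice of the function `u ↦ 1 - exp (u - 1)` makes the expected payoff independent of the
threshold `v`, as long as `v` can be outranked. -/
theorem le_integral_payoff {R v : ℝ} (hR : 0 < R) (hv : 0 ≤ v) :
    R * (1 - 1 / Real.exp 1) ≤ ∫ u, payoff R v u ∂uniform01 := by
  by_cases h : R * (1 - 1 / Real.exp 1) ≤ v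
  · have h1 : ∫ _, v ∂uniform01 ≤ ∫ u, payoff R v u ∂uniform01 := by
      refine integral_mono (integrable_const v) (integrable_payoff R v) fun u => ?_
      unfold payoff
      have := Real.exp_pos (u - 1)
      split_ifs
      · nlinarith
      · linarith
    simp only [integral_const, probReal_univ, one_smul] at h1
    exact h.trans h1
  · push Not at h
    have he : 0 < 1 / Real.exp 1 := by positivity
    have hvR : 1 / Real.exp 1 < 1 - v / R := by
      rw [lt_sub_comm, div_lt_iff₀ hR]
      linarith
    have hq : 0 < 1 - v / R := he.trans hvR
    set c := 1 + Real.log (1 - v / R) with hc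
    have hexp : Real.exp (c - 1) = 1 - v / R := by
      rw [hc, add_sub_cancel_left, Real.exp_log hq]
    have hc0 : 0 ≤ c := by
      have h1 : -1 < Real.log (1 - v / R) := by
        rw [Real.lt_log_iff_exp_lt hq, Real.exp_neg, ← one_div]
        exact hvR
      linarith
    have hc1 : c ≤ 1 := by
      have h1 : Real.log (1 - v / R) ≤ 0 :=
        Real.log_nonpos hq.le (by have := div_nonneg hv hR.le; linarith)
      linarith
    have hpay : ∀ u, payoff R v u
        = v + (Set.Iio c).indicator (fun u => R * Real.exp (u - 1)) u := by
      intro u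
      unfold payoff
      have hiff : v < R * (1 - Real.exp (u - 1)) ↔ u < c := by
        rw [mul_comm, ← div_lt_iff₀ hR, lt_sub_comm, ← hexp, Real.exp_lt_exp, sub_lt_sub_iff_right]
      by_cases hu : u < c
      · rw [if_pos (hiff.mpr hu), Set.indicator_of_mem (Set.mem_Iio.mpr hu), mul_one]
      · rw [if_neg (fun h => hu (hiff.mp h)), Set.indicator_of_notMem (by simpa using hu), mul_zero]
    have hint : Integrable ((Set.Iio c).indicator fun u => R * Real.exp (u - 1)) uniform01 := by
      refine Integrable.indicator ?_ measurableSet_Iio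
      exact (Continuous.integrableOn_Icc (by fun_prop))
    simp only [hpay]
    rw [integral_add (integrable_const v) hint, integral_indicator measurableSet_Iio,
      Measure.restrict_restrict measurableSet_Iio]
    have hset : Set.Iio c ∩ Set.Icc 0 1 = Set.Ico 0 c := by
      ext u
      simp only [Set.mem_inter_iff, Set.mem_Iio, Set.mem_Icc, Set.mem_Ico]
      constructor
      · exact fun h => ⟨h.2.1, h.1⟩
      · exact fun h => ⟨h.2, h.1, h.2.le.trans hc1⟩
    rw [hset, setIntegral_congr_set Ico_ae_eq_Ioc, ← intervalIntegral.integral_of_le hc0,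
      intervalIntegral.integral_const_mul,
      intervalIntegral.integral_comp_sub_right (fun u => Real.exp u), integral_exp, hexp]
    simp only [integral_const, probReal_univ, one_smul, zero_sub, Real.exp_neg]
    refine le_of_eq ?_
    field_simp
    ring

variable [Fintype I] [DecidableEq I] (ν : Instance I m)

/-- The expected value of the chain is integrable in the seeds when the costs are bounded. -/
theorem integrable_chainValue {c : (I → ℝ) → Fin m → Option I → ℝ}
    (hc : ∀ t o, Measurable fun y => c y t o) {C : ℝ}
    (hC : ∀ᵐ y ∂seedLaw I, ∀ t o, |c y t o| ≤ C) (L : List (Fin m)) (A : Finset I) :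
    Integrable (fun y => chainValue ν.p ν.nbr (best (rankLE ν y)) (c y) L A) (seedLaw I) := by
  simp only [fun y => chainValue_eq_sum (p := ν.p) (N := ν.nbr) (σ := best (rankLE ν y)) (c y) L A]
  refine integrable_finsetSum _ fun t _ => integrable_finsetSum _ fun o _ => ?_
  set W : (I → I → Prop) → ℝ := fun ρ => chainValue ν.p ν.nbr (best ρ)
    (fun t' o' => if t' = t ∧ o' = o then 1 else 0) L A with hW
  obtain ⟨D, hD⟩ := (Set.finite_range fun ρ => ‖W ρ‖).bddAbove
  refine Integrable.mul_bdd (c := D) ?_ ?_ ?_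
  · refine Integrable.of_bound (hc t o).aestronglyMeasurable C ?_
    filter_upwards [hC] with y hy
    exact hy t o
  · exact ((Measurable.of_discrete (f := W)).comp (measurable_rankLE ν)).aestronglyMeasurable
  · exact Filter.Eventually.of_forall fun y => hD ⟨rankLE ν y, rfl⟩

theorem integral_chainValue {Ω : Type*} [MeasurableSpace Ω] {μ : Measure Ω}
    {σ : Finset I → Option I} {c : Ω → Fin m → Option I → ℝ}
    (hc : ∀ t o, Integrable (fun u => c u t o) μ) (L : List (Fin m)) (A : Finset I) :
    ∫ u, chainValue ν.p ν.nbr σ (c u) L A ∂μ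
      = chainValue ν.p ν.nbr σ (fun t o => ∫ u, c u t o ∂μ) L A := by
  simp only [fun u => chainValue_eq_sum (p := ν.p) (N := ν.nbr) (σ := σ) (c u) L A]
  rw [chainValue_eq_sum, integral_finsetSum _ fun t _ =>
    integrable_finsetSum _ fun o _ => (hc t o).mul_const _]
  refine Finset.sum_congr rfl fun t _ => ?_
  rw [integral_finsetSum _ fun o _ => (hc t o).mul_const _]
  exact Finset.sum_congr rfl fun o _ => integral_mul_const _ _

theorem abs_rankValue_le {I : Type*} {m : ℕ} [Fintype I] (ν : Instance I m)
    {y : I → ℝ} (hy : ∀ i, y i ≤ 1) (o : Option I) :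
    |o.elim 0 (rankValue ν y)| ≤ ∑ i, ν.p i * ν.r i := by
  have hsum : ∀ i, ν.p i * ν.r i ≤ ∑ i, ν.p i * ν.r i := fun i =>
    Finset.single_le_sum (fun j _ => mul_reward_nonneg ν j) (Finset.mem_univ i)
  cases o with
  | none => simpa using Finset.sum_nonneg fun i _ => mul_reward_nonneg ν i
  | some i =>
    refine le_trans ?_ (hsum i)
    simp only [Option.elim, rankValue]
    rw [abs_mul, abs_of_nonneg (mul_reward_nonneg ν i)]
    refine mul_le_of_le_one_right (mul_reward_nonneg ν i) ?_
    have h1 : Real.exp (y i - 1) ≤ 1 := Real.exp_le_one_iff.mpr (by linarith [hy i])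
    rw [abs_le]
    constructor <;> linarith [Real.exp_pos (y i - 1)]

/-- The lower bound for the part of the reward of Perturbed Greedy that is attributed to the edges
of `i`, where `x t` is the weight that the benchmark puts on the edge `(i, t)`. The chain runs
without `i`, so that it does not depend on the seed of `i`. -/
def edgeBound (x : Fin m → ℝ) (L : List (Fin m)) (i : I) (y : I → ℝ) : ℝ :=
  chainValue ν.p ν.nbr (best (rankLE ν y))
    (fun t o => x t * payoff (ν.p i * ν.r i) (o.elim 0 (rankValue ν y)) (y i)) L
    ((profitable ν).erase i)

theorem integrable_edgeBound (x : Fin m → ℝ) (L : List (Fin m)) (i : I) :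
    Integrable (edgeBound ν x L i) (seedLaw I) := by
  refine integrable_chainValue ν (C := (∑ t, |x t|) *
    ((∑ i, ν.p i * ν.r i) + |ν.p i * ν.r i|)) (fun t o => ?_) ?_ L _
  · refine Measurable.const_mul ((measurable_payoff _).comp (Measurable.prodMk ?_
      (measurable_pi_apply i))) _
    cases o with
    | none => exact measurable_const
    | some j => exact measurable_rankValue ν j
  · filter_upwards [ae_seed_mem I] with y hy t o
    rw [abs_mul]
    refine mul_le_mul (Finset.single_le_sum (f := fun t => |x t|) (fun j _ => abs_nonneg _)
      (Finset.mem_univ t)) ?_ (abs_nonneg _) (Finset.sum_nonneg fun _ _ => abs_nonneg _)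
    refine (abs_payoff_le (hy i).2.le).trans ?_
    gcongr
    exact abs_rankValue_le ν (fun i => (hy i).2.le) o

/-- The seed of `i` is integrated out first, with the other seeds, and hence the thresholds of the
chain without `i`, held fixed. -/
theorem le_integral_edgeBound {x : Fin m → ℝ} (hx : ∀ t, 0 ≤ x t) (L : List (Fin m)) {i : I}
    (hi : i ∈ profitable ν) :
    (1 - 1 / Real.exp 1) * (ν.p i * ν.r i * (L.map x).sum)
      ≤ ∫ y, edgeBound ν x L i y ∂seedLaw I := by
  have hR : 0 < ν.p i * ν.r i := by simpa [profitable] using hi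
  have hmp := measurePreserving_update (I := I) i
  have hint := integrable_edgeBound ν x L i
  have hint' : Integrable (fun z : (I → ℝ) × ℝ => edgeBound ν x L i (Function.update z.1 i z.2))
      ((seedLaw I).prod uniform01) := (hmp.integrable_comp hint.aestronglyMeasurable).mpr hint
  have h1 : ∫ y, edgeBound ν x L i y ∂seedLaw I
      = ∫ y, ∫ u, edgeBound ν x L i (Function.update y i u) ∂uniform01 ∂seedLaw I := by
    rw [← integral_prod _ hint']
    conv_lhs => rw [← hmp.map_eq]
    exact integral_map hmp.measurable.aemeasurable (by rw [hmp.map_eq]; exact hint.1)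
  rw [h1]
  have h2 : ∀ᵐ y ∂seedLaw I, (1 - 1 / Real.exp 1) * (ν.p i * ν.r i * (L.map x).sum)
      ≤ ∫ u, edgeBound ν x L i (Function.update y i u) ∂uniform01 := by
    filter_upwards [ae_seed_mem I] with y hy
    have hval : ∀ j ≠ i, ∀ u, rankValue ν (Function.update y i u) j = rankValue ν y j := by
      intro j hj u
      simp [rankValue, hj]
    have h3 : ∀ u, edgeBound ν x L i (Function.update y i u)
        = chainValue ν.p ν.nbr (best (rankLE ν y))
          (fun t o => x t * payoff (ν.p i * ν.r i) (o.elim 0 (rankValue ν y)) u) L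
          ((profitable ν).erase i) := by
      intro u
      unfold edgeBound
      rw [chainValue_congr (σ' := best (rankLE ν y))]
      · refine chainValue_congr_cost ν.p_nonneg ν.p_le_one (selects_rank ν y) fun t _ o ho => ?_
        rw [Function.update_self]
        cases o with
        | none => rfl
        | some j =>
          have hj : j ≠ i := Finset.ne_of_mem_erase (ho j rfl)
          simp only [Option.elim, hval j hj]
      · refine fun B hB => best_congr fun j hj k hk => ?_
        rw [rankLE, rankLE, hval j (Finset.ne_of_mem_erase (hB hj)),
          hval k (Finset.ne_of_mem_erase (hB hk))]
    simp only [h3]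
    rw [integral_chainValue ν fun t o => (integrable_payoff _ _).const_mul _]
    have h4 := chainValue_time (p := ν.p) (N := ν.nbr) (σ := best (rankLE ν y))
      (fun t => (1 - 1 / Real.exp 1) * (ν.p i * ν.r i) * x t) L ((profitable ν).erase i)
    rw [List.sum_map_mul_left] at h4
    rw [← mul_assoc, ← h4]
    refine chainValue_mono_cost ν.p_nonneg ν.p_le_one (selects_rank ν y) fun t _ o _ => ?_
    rw [integral_const_mul, mul_comm]
    refine mul_le_mul_of_nonneg_left ?_ (hx t)
    rw [mul_comm]
    refine le_integral_payoff hR ?_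
    cases o with
    | none => exact le_rfl
    | some j =>
      refine mul_nonneg (mul_reward_nonneg ν j) ?_
      rw [sub_nonneg, Real.exp_le_one_iff]
      linarith [(hy j).2]
  have h5 := integral_mono_ae (integrable_const _) hint'.integral_prod_left h2
  simpa using h5

end Seeds

/-! ### The competitive ratio -/

section Competitive

variable {I : Type*} {m : ℕ} [Fintype I] [DecidableEq I] {ν : Instance I m}

/-- The value of the chain of Perturbed Greedy, when the arrivals with successful arrival variable
are those of the list `L`. -/
def greedyValue (ν : Instance I m) (L : List (Fin m)) (y : I → ℝ) : ℝ :=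
  chainValue ν.p ν.nbr (best (rankLE ν y)) (fun _ o => o.elim 0 fun i => ν.p i * ν.r i) L
    (profitable ν)

theorem integrable_greedyValue (ν : Instance I m) (L : List (Fin m)) :
    Integrable (greedyValue ν L) (seedLaw I) := by
  refine integrable_chainValue ν (c := fun _ _ o => o.elim 0 fun i => ν.p i * ν.r i)
    (C := ∑ i, ν.p i * ν.r i) (fun t o => measurable_const) ?_ L _
  refine Filter.Eventually.of_forall fun y t o => ?_
  cases o with
  | none => simpa using Finset.sum_nonneg fun i _ => mul_reward_nonneg ν i
  | some i =>
    simp only [Option.elim]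
    rw [abs_of_nonneg (mul_reward_nonneg ν i)]
    exact Finset.single_le_sum (fun j _ => mul_reward_nonneg ν j) (Finset.mem_univ i)

/-- The weight of a match is split into a share `rankValue ν y i` of the arrival and a share
`p i * r i * exp (y i - 1)` of the resource. The arrivals' shares are in turn distributed over
the edges with the weights `x`. -/
theorem sum_edgeBound_le_greedyValue {y : I → ℝ} (hy : Generic ν y) {x : I → Fin m → ℝ}
    (hx : ∀ i t, 0 ≤ x i t) (hx0 : ∀ i t, i ∉ ν.nbr t → x i t = 0) (hx1 : ∀ t, ∑ i, x i t ≤ 1)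
    {L : List (Fin m)} (hL : L.Nodup)
    (hxS : ∀ i (S : Finset (Fin m)), ν.p i * ∑ t ∈ S, x i t ≤ 1 - (1 - ν.p i) ^ S.card) :
    ∑ i ∈ profitable ν, edgeBound ν (x i) L i y ≤ greedyValue ν L y := by
  set σ := best (rankLE ν y)
  have hsel : Selects (rankValue ν y) σ := selects_rank ν y
  have hsplit : chainValue ν.p ν.nbr σ (fun t o =>
      (∑ i ∈ profitable ν, x i t * o.elim 0 (rankValue ν y)) + ∑ i ∈ profitable ν,
        ν.p i * ν.r i * Real.exp (y i - 1) * if o = some i then 1 else 0) L (profitable ν)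
      ≤ greedyValue ν L y := by
    refine chainValue_mono_cost ν.p_nonneg ν.p_le_one hsel fun t _ o ho => ?_
    cases o with
    | none => simp
    | some a =>
      have ha : a ∈ profitable ν := ho a rfl
      have h0 : (∑ i ∈ profitable ν,
          ν.p i * ν.r i * Real.exp (y i - 1) * if some a = some i then 1 else 0)
          = ν.p a * ν.r a * Real.exp (y a - 1) := by
        rw [Finset.sum_eq_single a (fun b _ hb => by simp [hb.symm]) (fun h => absurd ha h)]
        simp
      rw [← Finset.sum_mul, h0]
      have h1 : ∑ i ∈ profitable ν, x i t ≤ 1 :=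
        (Finset.sum_le_univ_sum_of_nonneg fun i => hx i t).trans (hx1 t)
      have h2 := mul_le_mul_of_nonneg_right h1 (hy.pos a ha).le
      simp only [Option.elim]
      unfold rankValue at h2 ⊢
      linarith
  refine le_trans ?_ hsplit
  rw [chainValue_add, chainValue_sum, chainValue_sum, ← Finset.sum_add_distrib]
  refine Finset.sum_le_sum fun i hi => ?_
  have h1 := chainValue_mono_state ν.p_nonneg ν.p_le_one (N := ν.nbr) hsel
    (fun i hi => (hy.pos i hi).le) hy.inj (hx i) L (Finset.erase_subset i (profitable ν))
    (Finset.Subset.refl _)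
  have h2 := chainValue_count_bound ν.p_nonneg ν.p_le_one (N := ν.nbr) hsel hy.pos hy.inj
    (x := x i) (i := i) hL (S := ∅) (by simp) (fun S' _ => hxS i S') (A := (profitable ν).erase i)
    hi (Finset.notMem_erase i _) (Finset.erase_subset _ _) (Finset.Subset.refl _) (by
      intro j hj
      rw [Finset.mem_erase]
      refine and_iff_right ?_
      rintro rfl
      exact lt_irrefl _ hj)
  rw [Finset.card_empty, pow_zero, one_mul, Finset.sum_empty, mul_zero, sub_zero] at h2
  have h3 := mul_le_mul_of_nonneg_left (sub_le_sub_iff_left 1 |>.mp h2)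
    (mul_nonneg (ν.r_nonneg i) (Real.exp_pos (y i - 1)).le)
  rw [chainValue_const_mul]
  have h4 : edgeBound ν (x i) L i y = chainValue ν.p ν.nbr σ
      (fun t o => x i t * o.elim 0 (rankValue ν y)) L ((profitable ν).erase i)
      + ν.p i * ν.r i * Real.exp (y i - 1) * chainValue ν.p ν.nbr σ (fun t o =>
        if i ∈ ν.nbr t ∧ o.elim 0 (rankValue ν y) < rankValue ν y i then x i t else 0) L
        ((profitable ν).erase i) := by
    rw [← chainValue_const_mul, ← chainValue_add]
    unfold edgeBound
    congr 1
    funext t o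
    unfold payoff
    change x i t * (_ + _ * if _ < rankValue ν y i then 1 else 0) = _
    by_cases hit : i ∈ ν.nbr t
    · by_cases h : o.elim 0 (rankValue ν y) < rankValue ν y i
      · simp only [h, hit, and_self, if_true]
        ring
      · simp only [h, hit, and_false, if_false]
        ring
    · simp [hx0 i t hit]
  rw [h4]
  linarith

/-- The competitive ratio for fixed arrival variables `s`, and a fixed seed of the algorithm. -/
theorem mean_reward_run_le (A : OfflineAlgorithm ν) (z : A.Seed) (s : Fin m → Bool) :
    (1 - 1 / Real.exp 1) * ν.mean (fun x => ν.reward (A.run z (fun i t => x i t && s t) m))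
      ≤ ∫ y, greedyValue ν ((List.finRange m).filter fun t => s t) y ∂seedLaw I := by
  set L := (List.finRange m).filter fun t => s t with hL
  have hLn : L.Nodup := (List.nodup_finRange m).filter _
  have h1 : ν.mean (fun x => ν.reward (A.run z (fun i t => x i t && s t) m))
      = ∑ i ∈ profitable ν, ν.p i * ν.r i * (L.map (tryProb A z s i)).sum := by
    rw [mean_reward_run]
    symm
    rw [← Finset.sum_subset (Finset.subset_univ (profitable ν))]
    · refine Finset.sum_congr rfl fun i _ => ?_
      rw [← Finset.mul_sum, ← List.sum_toFinset _ hLn]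
      congr 1
      refine Finset.sum_subset (Finset.subset_univ _) fun t _ ht => ?_
      have : s t ≠ true := fun h => ht (by simp [hL, h])
      simp [tryProb, this]
    · intro i _ hi
      simp [mul_reward_eq_zero hi]
  rw [h1, Finset.mul_sum]
  have h2 : ∑ i ∈ profitable ν, ∫ y, edgeBound ν (tryProb A z s i) L i y ∂seedLaw I
      ≤ ∫ y, greedyValue ν L y ∂seedLaw I := by
    rw [← integral_finsetSum _ fun i _ => integrable_edgeBound ν _ L i]
    refine integral_mono_ae (integrable_finsetSum _ fun i _ => integrable_edgeBound ν _ L i)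
      (integrable_greedyValue ν L) ?_
    filter_upwards [ae_generic ν] with y hy
    exact sum_edgeBound_le_greedyValue hy (tryProb_nonneg A z s)
      (fun i t hi => tryProb_eq_zero A z s hi) (sum_tryProb_le_one A z s) hLn
      fun i S => sum_tryProb_le_pow A z s i
  exact (Finset.sum_le_sum fun i hi =>
    le_integral_edgeBound ν (tryProb_nonneg A z s i) L hi).trans h2

theorem arrivalProb_pos {I : Type*} {m : ℕ} {ν : Instance I m} {s : Fin m → Bool}
    (hs : 0 < ν.joint s) {t : Fin m} (ht : s t = true) :
    0 < ν.arrivalProb t := by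
  have h : (if s t = true then ν.joint s else 0) ≤ ν.arrivalProb t :=
    Finset.single_le_sum (f := fun s : Fin m → Bool => if s t = true then ν.joint s else 0)
      (fun s _ => by split_ifs; exacts [ν.joint_nonneg s, le_rfl]) (Finset.mem_univ s)
  rw [if_pos ht] at h
  exact hs.trans_le h

/-- Only the arrival variables of positive probability matter, and for these every arrival with
`s t = 1` has a positive marginal probability, which thus does not affect the ranking. Seeds with
ties form a null set. -/
theorem perturbedGreedy_eq (ν : Instance I m) (tie : TieBreak I m) :
    ν.perturbedGreedy tie = ∑ s, ν.joint s *
      ∫ y, greedyValue ν ((List.finRange m).filter fun t => s t) y ∂seedLaw I := by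
  simp only [← integral_const_mul]
  rw [← integral_finsetSum _ fun s _ => (integrable_greedyValue ν _).const_mul _]
  refine integral_congr_ae ?_
  filter_upwards [ae_generic ν] with y hy
  rw [expectation_eq_sum_mean]
  refine Finset.sum_congr rfl fun s _ => ?_
  rcases (ν.joint_nonneg s).eq_or_lt with h | h
  · rw [← h, zero_mul, zero_mul]
  · rw [mean_reward_greedyRun tie hy fun t ht => arrivalProb_pos h ht]
    rfl

theorem reward_nonneg {I : Type*} {m : ℕ} (ν : Instance I m) (h : History I m) :
    0 ≤ ν.reward h := by
  refine List.sum_nonneg fun a ha => ?_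
  obtain ⟨e, -, rfl⟩ := List.mem_map.mp ha
  split_ifs
  exacts [ν.r_nonneg _, le_rfl]

theorem expectation_nonneg {F : (I → Fin m → Bool) → ℝ} (hF : ∀ w, 0 ≤ F w) :
    0 ≤ ν.expectation F := by
  rw [expectation_eq_sum_mean]
  exact Finset.sum_nonneg fun s _ => mul_nonneg (ν.joint_nonneg s)
    ((mean_const ν 0).ge.trans (mean_mono ν fun x => hF _))

theorem value_le (A : OfflineAlgorithm ν) (tie : TieBreak I m) :
    A.value ≤ (1 - 1 / Real.exp 1)⁻¹ * ν.perturbedGreedy tie := by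
  have he : 0 < 1 - 1 / Real.exp 1 := by
    rw [sub_pos, div_lt_one (Real.exp_pos 1)]
    exact Real.one_lt_exp_iff.mpr one_pos
  let := A.measurableSeed
  have := A.isProbability
  have h : ∀ z, ν.expectation (fun w => ν.reward (A.run z w m))
      ≤ (1 - 1 / Real.exp 1)⁻¹ * ν.perturbedGreedy tie := by
    intro z
    rw [le_inv_mul_iff₀ he, expectation_eq_sum_mean, perturbedGreedy_eq, Finset.mul_sum]
    refine Finset.sum_le_sum fun s _ => ?_
    rw [mul_left_comm]
    exact mul_le_mul_of_nonneg_left (mean_reward_run_le A z s) (ν.joint_nonneg s)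
  -- integrability in the seed of the algorithm is not needed, the integral being zero without it
  have h1 := integral_mono_of_nonneg (μ := A.law)
    (Filter.Eventually.of_forall fun z => expectation_nonneg fun w => reward_nonneg ν _)
    (integrable_const ((1 - 1 / Real.exp 1)⁻¹ * ν.perturbedGreedy tie))
    (Filter.Eventually.of_forall h)
  simp only [integral_const, probReal_univ, one_smul] at h1
  exact h1

end Competitive

end TimeCorrelated

end

theorem mainTheorem3 {I : Type*} [Fintype I] [DecidableEq I] {m : ℕ}
    (ν : TimeCorrelated.Instance I m) (tie : TimeCorrelated.TieBreak I m) :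
    BddAbove (Set.range fun A : TimeCorrelated.OfflineAlgorithm ν => A.value) ∧
      (1 - 1 / Real.exp 1) * ν.opt ≤ ν.perturbedGreedy tie := by
  have he : 0 < 1 - 1 / Real.exp 1 := by
    rw [sub_pos, div_lt_one (Real.exp_pos 1)]
    exact Real.one_lt_exp_iff.mpr one_pos
  have hnonneg : 0 ≤ ν.perturbedGreedy tie := integral_nonneg fun y =>
    TimeCorrelated.expectation_nonneg fun w => TimeCorrelated.reward_nonneg ν _
  constructor
  · refine ⟨(1 - 1 / Real.exp 1)⁻¹ * ν.perturbedGreedy tie, ?_⟩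
    rintro _ ⟨A, rfl⟩
    exact TimeCorrelated.value_le A tie
  · rw [← le_inv_mul_iff₀ he]
    exact Real.iSup_le (fun A => TimeCorrelated.value_le A tie)
      (mul_nonneg (inv_nonneg.mpr he.le) hnonneg)
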